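/- For real $\nu$ with $|\nu|\le\frac12$ let $$\mathbf H_\nu(z)=\frac{(z/2)^{\nu+1}}{\sqrt{\pi/4}\,\Gamma(\nu+\frac32)}\;{}_1F_2\!\left(1;\tfrac32,\nu+\tfrac32;-\tfrac{z^2}{4}\right)$$ be the Struve function of the first kind (a multivalued analytic function on $\mathbb C\setminus\{0\}$; on the positive real axis $\mathbf H_\nu$ denotes its principal branch). Then: (i) all zeros in $\mathbb C\setminus\{0\}$ of (every branch of) $\mathbf H_\nu$ are real; (ii) all zeros in $\mathbb C\setminus\{0\}$ of (every branch of) the derivative $\mathbf H_\nu'$ are real and simple; (iii) $\mathbf H_\nu$ and $\mathbf H_\nu'$ have infinitely many positive zeros, and these interlace: if $h_{\nu,1}\le h_{\nu,2}\le\cdots$ are the positive zeros of $\mathbf H_\nu$, repeated according to multiplicity, and $h'_{\nu,1}<h'_{\nu,2}<\cdots$ are the positive zeros of $\mathbf H_\nu'$, then $$h'_{\nu,n}\le h_{\nu,n}\le h'_{\nu,n+1}\qquad(n\ge 1).$$ If $\nu\neq\frac12$ all these inequalities are strict, $h'_{\nu,n}<h_{\nu,n}<h'_{\nu,n+1}$;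 in particular the zeros $h_{\nu,n}$ are then simple. (For $\nu=\frac12$ one has $\mathbf H_{1/2}(z)=\sqrt{2/(\pi z)}\,(1-\cos z)$, whose positive zeros are double, so that strict interlacing is impossible.) -/

import Mathlib

noncomputable section

/-- The generalized hypergeometric function `₁F₂(a; b, c; z)`, for `b`, `c` not non-positive
integers: Mathlib's regularized function times `Γ(b) Γ(c)`. -/
def hypergeometric1F2 (a b c z : ℂ) : ℂ :=
  Complex.Gamma b * Complex.Gamma c * Complex.regularizedHGFun {a} {b, c} z

/-- The usual series `₁F₂(a; b, c; z) = ∑ (a)ₙ / ((b)ₙ (c)ₙ) · zⁿ / n!`. -/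
theorem hypergeometric1F2_eq_tsum (a : ℂ) {b c : ℂ} (hb : ∀ k : ℕ, b ≠ -k)
    (hc : ∀ k : ℕ, c ≠ -k) (z : ℂ) :
    hypergeometric1F2 a b c z = ∑' n : ℕ, (ascPochhammer ℂ n).eval a /
      ((ascPochhammer ℂ n).eval b * (ascPochhammer ℂ n).eval c) *
        (z ^ n / (n.factorial : ℂ)) := by
  unfold hypergeometric1F2 Complex.regularizedHGFun
  rw [FormalMultilinearSeries.sum, ← tsum_mul_left]
  refine tsum_congr fun n => ?_
  have h1 : Complex.Gamma b ≠ 0 := Complex.Gamma_ne_zero hb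
  have h2 : Complex.Gamma c ≠ 0 := Complex.Gamma_ne_zero hc
  rw [← Complex.Gamma_add_nat_div_Gamma_eq b hb, ← Complex.Gamma_add_nat_div_Gamma_eq c hc]
  simp [Complex.regularizedHGFunSeries, Complex.regularizedHGFunCoeff]
  field_simp

/-- The Struve function of the first kind of real order `ν`,
`H_ν(z) = (z/2)^(ν+1) / (√(π/4) Γ(ν+3/2)) · ₁F₂(1; 3/2, ν+3/2; -z²/4)`,
where the power is the principal one; it is holomorphic on `ℂ` minus `(-∞, 0]`. -/
def struveH (ν : ℝ) (z : ℂ) : ℂ :=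
  (z / 2) ^ ((ν : ℂ) + 1) / ((Real.sqrt (Real.pi / 4) * Real.Gamma (ν + 3 / 2) : ℝ) : ℂ) *
    hypergeometric1F2 1 (3 / 2) ((ν : ℂ) + 3 / 2) (-z ^ 2 / 4)

/-- `L` is a holomorphic branch of the logarithm on the open set `U`. -/
structure IsLogBranch (U : Set ℂ) (L : ℂ → ℂ) : Prop where
  isOpen : IsOpen U
  differentiableOn : DifferentiableOn ℂ L U
  exp_eq : ∀ z ∈ U, Complex.exp (L z) = z

/-- The branch of the (multivalued) Struve function `H_ν` which belongs to the branch `L` of the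
logarithm: the power `(z/2)^(ν+1)` is read as `exp ((ν+1) (L z - log 2))`. -/
def struveBranch (ν : ℝ) (L : ℂ → ℂ) (z : ℂ) : ℂ :=
  Complex.exp (((ν : ℂ) + 1) * (L z - (Real.log 2 : ℝ))) /
      ((Real.sqrt (Real.pi / 4) * Real.Gamma (ν + 3 / 2) : ℝ) : ℂ) *
    hypergeometric1F2 1 (3 / 2) ((ν : ℂ) + 3 / 2) (-z ^ 2 / 4)

/-- The principal branch of the logarithm gives `struveH`. -/
theorem struveBranch_log (ν : ℝ) {z : ℂ} (hz : z ≠ 0) :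
    struveBranch ν Complex.log z = struveH ν z := by
  have h2 : Complex.log (z / 2) = Complex.log z - (Real.log 2 : ℝ) := by
    have h := Complex.log_ofReal_mul (r := 1 / 2) (by norm_num) hz
    have e : (((1 / 2 : ℝ) : ℂ)) * z = z / 2 := by push_cast; ring
    rw [e] at h
    rw [h, one_div, Real.log_inv]
    push_cast
    ring
  unfold struveBranch struveH
  rw [Complex.cpow_def_of_ne_zero (div_ne_zero hz two_ne_zero), h2,
    mul_comm (Complex.log z - _)]

/-- The sequence `a` lists, in non-decreasing order, the zeros of `f` on the positive real axis,
each one repeated according to its multiplicity. -/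
structure EnumeratesPosZeros (f : ℂ → ℂ) (a : ℕ → ℝ) : Prop where
  pos : ∀ n, 0 < a n
  monotone : Monotone a
  multiplicity : ∀ x : ℝ, 0 < x → {n : ℕ | a n = x}.encard = analyticOrderAt f (x : ℂ)

end

/-! Put a = ν + 1 and q = `struveEntire ν`. Every branch of the Struve function is c z^a q(z²) with
q entire and q(0) = 1, and its derivative is c z^(a-1) d(z²) with d = `sqLogDeriv a q` = a q + 2 w
q'. The core is `posRootLimit_struveEntire`: q is a locally uniform limit, off a discrete set, of
polynomials ∏ (1 - μ w) with all μ > 0.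

For such a q, the zeros are positive, w q'/q sends the upper half plane to the lower one, and x q'/q
decreases between consecutive real zeros. Where q ≠ 0, the equation d = 0 says w q'/q = -a/2. So the
zeros of d are positive and simple, and each gap between positive zeros of q contains at most one of
them. Rolle's theorem supplies one, also in the gap starting at 0, because z^a vanishes there.
Strict inequalities are lost in a limit, so they are carried as Cauchy–Schwarz estimates
(`posRootProd_im_bound`, `posRootProd_laguerre`) whose constant ∑ μ = -p'(0) converges.

For ν = -1/2, q(z²) = sin z / z and the polynomials come from Euler's product. For ν = 1/2, q(w) is
the square of that function at w/4. For -1/2 < ν < 1/2, z q(z²) is a positive multiple of ∫₀¹ (1 -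
t²)^(ν-1/2) sin(zt) dt, which has sign (-1)^n at (n+1)π (`struveWeight_integral_sin_pos`). With λ_n
= ((n+1)π)² this gives q_ν/q_{-1/2} = 1 + ∑ r_n w/(λ_n - w) with r_n > 0 (`hasSum_struveResidue`),
and the behaviour at -∞ bounds ∑ r_n by 1. Truncated expansions times truncated Euler products are
then polynomials with positive roots only (`struvePoly_roots`). The same expansion puts exactly one
positive zero of q, a simple one, in each (λ_n, λ_{n+1}), and no others. -/

open Polynomial Filter Topology MeasureTheory

noncomputable section

/-! ### Polynomials with positive roots -/

/-- The real polynomial with value `1` at `0` whose roots are the reciprocals of the elements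
of `s`. -/
def posRootProd (s : Multiset ℝ) : ℝ[X] := (s.map fun μ => 1 - C μ * X).prod

theorem posRootProd_zero : posRootProd 0 = 1 := by simp [posRootProd]

theorem posRootProd_cons (μ : ℝ) (s : Multiset ℝ) :
    posRootProd (μ ::ₘ s) = (1 - C μ * X) * posRootProd s := by
  simp [posRootProd]

theorem eval_zero_posRootProd (s : Multiset ℝ) : (posRootProd s).eval 0 = 1 := by
  induction s using Multiset.induction_on with
  | empty => simp [posRootProd_zero]
  | cons μ s ih => simp [posRootProd_cons, ih]

theorem eval_zero_derivative_posRootProd (s : Multiset ℝ) :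
    (derivative (posRootProd s)).eval 0 = -s.sum := by
  induction s using Multiset.induction_on with
  | empty => simp [posRootProd_zero]
  | cons μ s ih => simp [posRootProd_cons, ih, eval_zero_posRootProd]; ring

theorem aeval_posRootProd (s : Multiset ℝ) (w : ℂ) :
    aeval w (posRootProd s) = (s.map fun μ : ℝ => 1 - (μ : ℂ) * w).prod := by
  induction s using Multiset.induction_on with
  | empty => simp [posRootProd_zero]
  | cons μ s ih => simp [posRootProd_cons, ih]

/-- Multiplied by S, the right side is (S X - |u|² y) + y |u + S a|². This is the step that adds one
factor in the two Cauchy–Schwarz inductions below. -/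
theorem inner_bound_of_sq_le {S X y u₁ u₂ a₁ a₂ : ℝ} (hS : 0 ≤ S) (hX : 0 ≤ X) (hy : 0 < y)
    (h : (u₁ ^ 2 + u₂ ^ 2) * y ≤ S * X) :
    0 ≤ X + S * (a₁ ^ 2 + a₂ ^ 2) * y + 2 * y * (u₁ * a₁ + u₂ * a₂) := by
  rcases hS.eq_or_lt with rfl | hS
  · have h0 : u₁ ^ 2 + u₂ ^ 2 ≤ 0 := by
      rw [zero_mul] at h
      exact nonpos_of_mul_nonpos_left h hy
    have h1 : u₁ = 0 := by nlinarith [sq_nonneg u₁, sq_nonneg u₂]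
    have h2 : u₂ = 0 := by nlinarith [sq_nonneg u₁, sq_nonneg u₂]
    subst h1 h2
    simpa using hX
  · refine (mul_nonneg_iff_of_pos_left hS).1 ?_
    have h3 : 0 ≤ y * ((u₁ + S * a₁) ^ 2 + (u₂ + S * a₂) ^ 2) := by positivity
    nlinarith

theorem sum_nonneg_of_pos {s : Multiset ℝ} (hs : ∀ μ ∈ s, 0 < μ) : 0 ≤ s.sum :=
  Multiset.sum_nonneg fun μ h => (hs μ h).le

/-- Quantitative form of the fact that `w p'(w) / p(w)` maps the upper half plane to the lower
one, for a polynomial `p` with positive roots. -/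
theorem posRootProd_im_bound {s : Multiset ℝ} (hs : ∀ μ ∈ s, 0 < μ) {w : ℂ} (hw : 0 < w.im) :
    0 ≤ -(w * aeval w (derivative (posRootProd s)) *
        (starRingEnd ℂ) (aeval w (posRootProd s))).im ∧
      Complex.normSq (aeval w (derivative (posRootProd s))) * w.im ≤
      s.sum * -(w * aeval w (derivative (posRootProd s)) *
        (starRingEnd ℂ) (aeval w (posRootProd s))).im := by
  -- Since p'/p = -∑ μ/(1 - μw), the bound is Cauchy–Schwarz, |p'/p|² ≤ (∑ μ)(∑ μ/|1 - μw|²),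
  -- multiplied by |p|² Im w. The induction avoids division.
  induction s using Multiset.induction_on with
  | empty => simp [posRootProd_zero]
  | cons μ s ih =>
    have hs' : ∀ x ∈ s, 0 < x := fun x hx => hs x (Multiset.mem_cons_of_mem hx)
    have hμ := hs μ (Multiset.mem_cons_self μ s)
    have hS := sum_nonneg_of_pos hs'
    obtain ⟨h0, h1⟩ := ih hs'
    have e1 : aeval w (posRootProd (μ ::ₘ s)) = (1 - μ * w) * aeval w (posRootProd s) := by
      simp [posRootProd_cons]
    have e2 : aeval w (derivative (posRootProd (μ ::ₘ s))) =
        (1 - μ * w) * aeval w (derivative (posRootProd s)) - μ * aeval w (posRootProd s) := by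
      simp [posRootProd_cons]; ring
    rw [e1, e2, Multiset.sum_cons]
    generalize aeval w (posRootProd s) = a at *
    generalize aeval w (derivative (posRootProd s)) = b at *
    set A := -(w * b * (starRingEnd ℂ) a).im with hA
    have key : -(w * ((1 - μ * w) * b - μ * a) * (starRingEnd ℂ) ((1 - μ * w) * a)).im =
        Complex.normSq (1 - μ * w) * A + μ * Complex.normSq a * w.im := by
      rw [hA]
      simp [Complex.normSq_apply]
      ring
    rw [key]
    have hg := Complex.normSq_nonneg (1 - μ * w)
    have ha := Complex.normSq_nonneg a
    have hX : 0 ≤ Complex.normSq (1 - μ * w) * A := mul_nonneg hg h0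
    refine ⟨by positivity, ?_⟩
    set u := (1 - μ * w) * b with hu
    have hb : Complex.normSq u * w.im ≤ s.sum * (Complex.normSq (1 - μ * w) * A) := by
      rw [hu, Complex.normSq_mul]
      nlinarith [mul_le_mul_of_nonneg_left h1 hg]
    have hc := inner_bound_of_sq_le (S := s.sum) (y := w.im) (u₁ := u.re) (u₂ := u.im)
      (a₁ := a.re) (a₂ := a.im) hS hX hw (by rw [Complex.normSq_apply] at hb; linarith)
    have hd : Complex.normSq (u - μ * a) = Complex.normSq u + μ ^ 2 * Complex.normSq a -
        2 * μ * (u.re * a.re + u.im * a.im) := by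
      simp [Complex.normSq_apply]; ring
    rw [hd]
    have he : a.re ^ 2 + a.im ^ 2 = Complex.normSq a := by rw [Complex.normSq_apply]; ring
    rw [he] at hc
    nlinarith [mul_nonneg hμ.le hc]

/-- Laguerre's inequality, in quantitative form, for a polynomial with positive roots. -/
theorem posRootProd_laguerre {s : Multiset ℝ} (hs : ∀ μ ∈ s, 0 < μ) (x : ℝ) :
    let p := (posRootProd s).eval x
    let p₁ := (derivative (posRootProd s)).eval x
    let p₂ := (derivative (derivative (posRootProd s))).eval x
    0 ≤ x * p₁ ^ 2 - x * p * p₂ - p * p₁ ∧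
      p₁ ^ 2 ≤ s.sum * (x * p₁ ^ 2 - x * p * p₂ - p * p₁) := by
  -- Off the roots the bracket is -p² (x p'/p)' = p² ∑ μ/(1 - μx)², so the bound is again
  -- Cauchy–Schwarz; the division-free form also covers the roots.
  induction s using Multiset.induction_on with
  | empty => simp [posRootProd_zero]
  | cons μ s ih =>
    have hs' : ∀ x ∈ s, 0 < x := fun x hx => hs x (Multiset.mem_cons_of_mem hx)
    have hμ := hs μ (Multiset.mem_cons_self μ s)
    have hS := sum_nonneg_of_pos hs'
    obtain ⟨h0, h1⟩ := ih hs'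
    simp only [posRootProd_cons, derivative_mul, derivative_sub, derivative_one, derivative_C,
      derivative_X, zero_mul, zero_add, mul_one, zero_sub, eval_mul, eval_sub, eval_one, eval_C,
      eval_X, eval_add, eval_neg, derivative_add, derivative_neg, neg_zero, Multiset.sum_cons]
      at h0 h1 ⊢
    generalize (posRootProd s).eval x = a at *
    generalize (derivative (posRootProd s)).eval x = b at *
    generalize (derivative (derivative (posRootProd s))).eval x = c at *
    set A := x * b ^ 2 - x * a * c - a * b with hA
    have hX : 0 ≤ (1 - μ * x) ^ 2 * A := by positivity
    have key : x * (-μ * a + (1 - μ * x) * b) ^ 2 -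
        x * ((1 - μ * x) * a) * (-μ * b + (-μ * b + (1 - μ * x) * c)) -
        (1 - μ * x) * a * (-μ * a + (1 - μ * x) * b) = (1 - μ * x) ^ 2 * A + μ * a ^ 2 := by
      rw [hA]; ring
    rw [key]
    refine ⟨by positivity, ?_⟩
    have hc := inner_bound_of_sq_le (S := s.sum) (y := 1) (u₁ := (1 - μ * x) * b) (u₂ := 0)
      (a₁ := a) (a₂ := 0) hS hX one_pos
      (by nlinarith [mul_le_mul_of_nonneg_left h1 (sq_nonneg (1 - μ * x))])
    nlinarith [mul_nonneg hμ.le hc, mul_le_mul_of_nonneg_left h1 (sq_nonneg (1 - μ * x))]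

/-- Each factor satisfies |1 - μ(x + iy)|² = (1 - μx)² + μ²y². Being a weak inequality it survives
limits, and it plays the role of Hurwitz's theorem. -/
theorem posRootProd_norm_mono {s : Multiset ℝ} (x : ℝ) {y y' : ℝ} (h : |y'| ≤ |y|) :
    ‖aeval (x + y' * Complex.I : ℂ) (posRootProd s)‖ ≤
      ‖aeval (x + y * Complex.I : ℂ) (posRootProd s)‖ := by
  induction s using Multiset.induction_on with
  | empty => simp [posRootProd_zero]
  | cons μ s ih =>
    simp only [posRootProd_cons, map_mul, norm_mul, map_sub, map_one, aeval_C, aeval_X]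
    refine mul_le_mul ?_ ih (norm_nonneg _) (norm_nonneg _)
    rw [Complex.norm_def, Complex.norm_def]
    apply Real.sqrt_le_sqrt
    have := sq_le_sq.2 h
    simp [Complex.normSq_apply]
    nlinarith [mul_le_mul_of_nonneg_left this (sq_nonneg μ)]

theorem posRootProd_nonpos {s : Multiset ℝ} (hs : ∀ μ ∈ s, 0 < μ) {x : ℝ} (hx : x ≤ 0) :
    1 ≤ (posRootProd s).eval x ∧ (derivative (posRootProd s)).eval x ≤ 0 := by
  induction s using Multiset.induction_on with
  | empty => simp [posRootProd_zero]
  | cons μ s ih =>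
    have hμ := hs μ (Multiset.mem_cons_self μ s)
    obtain ⟨h0, h1⟩ := ih fun x hx => hs x (Multiset.mem_cons_of_mem hx)
    have h2 : 1 ≤ 1 - μ * x := by nlinarith
    simp [posRootProd_cons]
    constructor <;> nlinarith

theorem aeval_ofReal_eq (p : ℝ[X]) (x : ℝ) : aeval (x : ℂ) p = ((p.eval x : ℝ) : ℂ) := by
  simpa using aeval_algebraMap_apply ℂ x p

/-! ### Limits of polynomials with positive roots -/

/-- The squares of the positive zeros of the sine function. -/
def sinZeroSq (n : ℕ) : ℝ := ((n + 1) * Real.pi) ^ 2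

theorem sinZeroSq_pos (n : ℕ) : 0 < sinZeroSq n := by
  unfold sinZeroSq; positivity

/-- The complement in `ℂ` of the set of squares of positive zeros of the sine function. -/
def sinPoleCompl : Set ℂ := (Set.range fun n => (sinZeroSq n : ℂ))ᶜ

theorem tendsto_sinZeroSq : Tendsto sinZeroSq atTop atTop := by
  unfold sinZeroSq
  refine (tendsto_pow_atTop two_ne_zero).comp (Tendsto.atTop_mul_const Real.pi_pos ?_)
  exact tendsto_atTop_add_const_right _ _ tendsto_natCast_atTop_atTop

theorem isOpen_sinPoleCompl : IsOpen sinPoleCompl := by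
  rw [sinPoleCompl, isOpen_compl_iff]
  have h : IsProperMap fun n : ℕ => (sinZeroSq n : ℂ) := by
    rw [isProperMap_iff_tendsto_cocompact]
    refine ⟨continuous_of_discreteTopology, ?_⟩
    rw [cocompact_eq_cofinite, Nat.cofinite_eq_atTop, ← Metric.cobounded_eq_cocompact,
      ← tendsto_norm_atTop_iff_cobounded]
    refine tendsto_sinZeroSq.congr fun n => ?_
    rw [Complex.norm_real, Real.norm_of_nonneg (sinZeroSq_pos n).le]
  exact h.isClosedMap.isClosed_range

theorem mem_sinPoleCompl_of_im_ne_zero {w : ℂ} (hw : w.im ≠ 0) : w ∈ sinPoleCompl := by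
  rintro ⟨n, rfl⟩
  simp at hw

theorem mem_sinPoleCompl_of_nonpos {x : ℝ} (hx : x ≤ 0) : (x : ℂ) ∈ sinPoleCompl := by
  rintro ⟨n, h⟩
  have := sinZeroSq_pos n
  have h' : sinZeroSq n = x := Complex.ofReal_injective h
  linarith

theorem zero_mem_sinPoleCompl : (0 : ℂ) ∈ sinPoleCompl := by
  simpa using mem_sinPoleCompl_of_nonpos le_rfl

theorem dense_ofReal_preimage_sinPoleCompl : Dense {x : ℝ | (x : ℂ) ∈ sinPoleCompl} := by
  have h : {x : ℝ | (x : ℂ) ∈ sinPoleCompl} = (Set.range sinZeroSq)ᶜ := by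
    ext x; simp [sinPoleCompl]
  rw [h]
  exact (Set.countable_range _).dense_compl ℝ

/-- `q` is a limit, locally uniform off the set of squares of the zeros of the sine function, of
polynomials with positive roots and value `1` at `0`. -/
def PosRootLimit (q : ℂ → ℂ) : Prop :=
  ∃ s : ℕ → Multiset ℝ, (∀ n, ∀ μ ∈ s n, 0 < μ) ∧
    TendstoLocallyUniformlyOn (fun n w => aeval w (posRootProd (s n))) q atTop sinPoleCompl

theorem deriv_aeval_eq (p : ℝ[X]) : deriv (fun w : ℂ => aeval w p) = fun w => aeval w (derivative p) := by
  funext w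
  exact (p.hasDerivAt_aeval w).deriv

namespace PosRootLimit

theorem tendsto_derivs {q : ℂ → ℂ} {s : ℕ → Multiset ℝ}
    (h : TendstoLocallyUniformlyOn (fun n w => aeval w (posRootProd (s n))) q atTop sinPoleCompl)
    {w : ℂ} (hw : w ∈ sinPoleCompl) :
    Tendsto (fun n => aeval w (posRootProd (s n))) atTop (𝓝 (q w)) ∧
    Tendsto (fun n => aeval w (derivative (posRootProd (s n)))) atTop (𝓝 (deriv q w)) ∧
    Tendsto (fun n => aeval w (derivative (derivative (posRootProd (s n))))) atTop
      (𝓝 (deriv (deriv q) w)) := by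
  have hd : ∀ p : ℝ[X], DifferentiableOn ℂ (fun w : ℂ => aeval w p) sinPoleCompl :=
    fun p => p.differentiable_aeval.differentiableOn
  have h1 := h.deriv (Eventually.of_forall fun n => hd _) isOpen_sinPoleCompl
  have h1' : TendstoLocallyUniformlyOn (fun n w => aeval w (derivative (posRootProd (s n))))
      (deriv q) atTop sinPoleCompl := by
    convert! h1 using 2 with n
    exact (deriv_aeval_eq _).symm
  have h2 := h1'.deriv (Eventually.of_forall fun n => hd _) isOpen_sinPoleCompl
  refine ⟨h.tendsto_at hw, h1'.tendsto_at hw, ?_⟩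
  refine (h2.tendsto_at hw).congr fun n => ?_
  simp only [Function.comp_apply]
  rw [deriv_aeval_eq]

variable {q : ℂ → ℂ}

/-- The sum of the μ is -p'(0), so the constant in the quantitative bounds converges and the bounds
pass to the limit. -/
theorem tendsto_sum {s : ℕ → Multiset ℝ}
    (h : TendstoLocallyUniformlyOn (fun n w => aeval w (posRootProd (s n))) q atTop sinPoleCompl) :
    Tendsto (fun n => (s n).sum) atTop (𝓝 (-(deriv q 0)).re) := by
  have h0 := (tendsto_derivs h zero_mem_sinPoleCompl).2.1
  refine ((Complex.continuous_re.tendsto _).comp h0.neg).congr fun n => ?_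
  have := aeval_ofReal_eq (derivative (posRootProd (s n))) 0
  simp only [Complex.ofReal_zero] at this
  simp [Function.comp, this, eval_zero_derivative_posRootProd]

theorem apply_zero (h : PosRootLimit q) : q 0 = 1 := by
  obtain ⟨s, hs, hl⟩ := h
  refine tendsto_nhds_unique (tendsto_derivs hl zero_mem_sinPoleCompl).1 ?_
  refine tendsto_const_nhds.congr fun n => ?_
  have := aeval_ofReal_eq (posRootProd (s n)) 0
  simp only [Complex.ofReal_zero] at this
  simp [this, eval_zero_posRootProd]

theorem im_bound (h : PosRootLimit q) {w : ℂ} (hw : 0 < w.im) :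
    Complex.normSq (deriv q w) * w.im ≤
      (-(deriv q 0)).re * -(w * deriv q w * (starRingEnd ℂ) (q w)).im := by
  obtain ⟨s, hs, hl⟩ := h
  obtain ⟨h0, h1, -⟩ := tendsto_derivs hl (mem_sinPoleCompl_of_im_ne_zero hw.ne')
  refine le_of_tendsto_of_tendsto' (((Complex.continuous_normSq.tendsto _).comp h1).mul_const _)
    ((tendsto_sum hl).mul ?_) fun n => (posRootProd_im_bound (hs n) hw).2
  exact ((Complex.continuous_im.tendsto _).comp ((h1.const_mul w).mul
    ((Complex.continuous_conj.tendsto _).comp h0))).neg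

theorem norm_mono (h : PosRootLimit q) (x : ℝ) {y y' : ℝ} (hy' : y' ≠ 0) (hyy : |y'| ≤ |y|) :
    ‖q (x + y' * Complex.I)‖ ≤ ‖q (x + y * Complex.I)‖ := by
  obtain ⟨s, hs, hl⟩ := h
  have hy : y ≠ 0 := by
    rintro rfl
    simp at hyy
    exact hy' hyy
  have h1 := (tendsto_derivs hl (w := x + y' * Complex.I)
    (mem_sinPoleCompl_of_im_ne_zero (by simpa using hy'))).1
  have h2 := (tendsto_derivs hl (w := x + y * Complex.I)
    (mem_sinPoleCompl_of_im_ne_zero (by simpa using hy))).1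
  exact le_of_tendsto_of_tendsto' h1.norm h2.norm fun n => posRootProd_norm_mono x hyy

theorem re_nonpos (h : PosRootLimit q) {x : ℝ} (hx : x ≤ 0) :
    1 ≤ (q x).re ∧ (deriv q x).re ≤ 0 := by
  obtain ⟨s, hs, hl⟩ := h
  obtain ⟨h0, h1, -⟩ := tendsto_derivs hl (mem_sinPoleCompl_of_nonpos hx)
  constructor
  · refine ge_of_tendsto' ((Complex.continuous_re.tendsto _).comp h0) fun n => ?_
    simpa [aeval_ofReal_eq] using (posRootProd_nonpos (hs n) hx).1
  · refine le_of_tendsto' ((Complex.continuous_re.tendsto _).comp h1) fun n => ?_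
    simpa [aeval_ofReal_eq] using (posRootProd_nonpos (hs n) hx).2

/-- Convergence is only known off the poles, but these are countable and both sides are continuous
in x, so density suffices. -/
theorem laguerre (h : PosRootLimit q) (hq : Differentiable ℂ q) (x : ℝ) :
    (deriv q x).re ^ 2 ≤ (-(deriv q 0)).re *
      (x * (deriv q x).re ^ 2 - x * (q x).re * (deriv (deriv q) x).re
        - (q x).re * (deriv q x).re) := by
  obtain ⟨s, hs, hl⟩ := h
  have c0 : Continuous fun x : ℝ => (q x).re := by
    have := hq.continuous
    fun_prop
  have c1 : Continuous fun x : ℝ => (deriv q x).re := by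
    have := (hq.contDiff (n := 2)).continuous_deriv (by norm_num)
    fun_prop
  have c2 : Continuous fun x : ℝ => (deriv (deriv q) x).re := by
    have h1 : Differentiable ℂ (deriv q) := hq.deriv
    have := (h1.contDiff (n := 2)).continuous_deriv (by norm_num)
    fun_prop
  have hcl : IsClosed {x : ℝ | (deriv q x).re ^ 2 ≤ (-(deriv q 0)).re *
      (x * (deriv q x).re ^ 2 - x * (q x).re * (deriv (deriv q) x).re
        - (q x).re * (deriv q x).re)} := isClosed_le (by fun_prop) (by fun_prop)
  have hmem : x ∈ closure {x : ℝ | (x : ℂ) ∈ sinPoleCompl} := dense_ofReal_preimage_sinPoleCompl x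
  refine closure_minimal ?_ hcl hmem
  intro x hx
  obtain ⟨h0, h1, h2⟩ := tendsto_derivs hl hx
  have r0 := (Complex.continuous_re.tendsto _).comp h0
  have r1 := (Complex.continuous_re.tendsto _).comp h1
  have r2 := (Complex.continuous_re.tendsto _).comp h2
  simp only [Function.comp_def, aeval_ofReal_eq, Complex.ofReal_re] at r0 r1 r2
  refine le_of_tendsto_of_tendsto' (r1.pow 2) ((tendsto_sum hl).mul
    ((((r1.pow 2).const_mul x).sub ((r0.const_mul x).mul r2)).sub (r0.mul r1)))
    fun n => (posRootProd_laguerre (hs n) x).2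

/-- By `norm_mono` a nonreal zero forces zeros at all smaller positive heights over the same real
part, hence q ≡ 0, against q(0) = 1. On the nonpositive axis the real part of q is at least 1. -/
theorem zeros_pos (h : PosRootLimit q) (hq : Differentiable ℂ q) {w : ℂ} (hw : q w = 0) :
    w.im = 0 ∧ 0 < w.re := by
  have him : w.im = 0 := by
    by_contra hne
    have hline : ∀ t : ℝ, t ∈ Set.Ioo 0 |w.im| → q (w.re + t * Complex.I) = 0 := by
      intro t ht
      have := h.norm_mono w.re (y := w.im) (y' := t) ht.1.ne' (by rw [abs_of_pos ht.1]; exact ht.2.le)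
      rw [Complex.re_add_im, hw, norm_zero] at this
      exact norm_le_zero_iff.1 this
    have ht0 : 0 < |w.im| / 2 := by positivity
    set z₀ : ℂ := w.re + ((|w.im| / 2 : ℝ) : ℂ) * Complex.I with hz₀
    have hfreq : ∃ᶠ z in 𝓝[≠] z₀, q z = 0 := by
      have htend : Tendsto (fun t : ℝ => (w.re + t * Complex.I : ℂ)) (𝓝[≠] (|w.im| / 2))
          (𝓝[≠] z₀) := by
        refine tendsto_nhdsWithin_of_tendsto_nhds_of_eventually_within _ ?_ ?_
        · exact tendsto_nhdsWithin_of_tendsto_nhds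
            (Continuous.tendsto (by fun_prop) (|w.im| / 2))
        · filter_upwards [self_mem_nhdsWithin] with t ht
          simp only [Set.mem_compl_iff, Set.mem_singleton_iff, hz₀] at ht ⊢
          intro h
          apply ht
          simpa using congrArg Complex.im h
      refine htend.frequently (Eventually.frequently ?_)
      filter_upwards [nhdsWithin_le_nhds (Ioo_mem_nhds ht0 (half_lt_self (abs_pos.2 hne)))]
        with t ht using hline t ht
    have han : AnalyticOnNhd ℂ q Set.univ := fun z _ => hq.analyticAt z
    have := han.eqOn_zero_of_preconnected_of_frequently_eq_zero isPreconnected_univ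
      (Set.mem_univ z₀) hfreq (Set.mem_univ 0)
    rw [h.apply_zero] at this
    exact one_ne_zero this
  refine ⟨him, ?_⟩
  by_contra hre
  have h1 := (h.re_nonpos (not_lt.1 hre)).1
  have : (w.re : ℂ) = w := by apply Complex.ext <;> simp [him]
  rw [this, hw] at h1
  norm_num at h1

end PosRootLimit

/-! ### The entire factor of the Struve function -/

/-- The entire function `₁F₂(1; 3/2, ν + 3/2; -w/4)`. -/
def struveEntire (ν : ℝ) (w : ℂ) : ℂ :=
  hypergeometric1F2 1 (3 / 2) ((ν : ℂ) + 3 / 2) (-w / 4)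

/-- The coefficient of `(-w) ^ n` in `struveEntire ν w`. -/
def struveCoeff (ν : ℝ) (n : ℕ) : ℝ :=
  n.factorial / ((2 * n + 1).factorial * (ascPochhammer ℝ n).eval (ν + 3 / 2))

theorem eval_ascPochhammer_three_half (n : ℕ) :
    (ascPochhammer ℂ n).eval (3 / 2 : ℂ) * (4 ^ n * n.factorial) = (2 * n + 1).factorial := by
  induction n with
  | zero => simp
  | succ n ih =>
    rw [ascPochhammer_succ_eval, show 2 * (n + 1) + 1 = (2 * n + 1) + 1 + 1 by ring,
      Nat.factorial_succ (2 * n + 1 + 1), Nat.factorial_succ (2 * n + 1), Nat.factorial_succ n]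
    push_cast
    rw [← ih]
    ring

theorem eval_ascPochhammer_ofReal (x : ℝ) (n : ℕ) :
    (ascPochhammer ℂ n).eval (x : ℂ) = ((ascPochhammer ℝ n).eval x : ℝ) := by
  rw [← ascPochhammer_map Complex.ofRealHom n, eval_map]
  exact (eval₂_at_apply Complex.ofRealHom x)

theorem ascPochhammer_eval_mono (n : ℕ) {x y : ℝ} (hx : 0 < x) (hxy : x ≤ y) :
    (ascPochhammer ℝ n).eval x ≤ (ascPochhammer ℝ n).eval y := by
  induction n with
  | zero => simp
  | succ n ih =>
    rw [ascPochhammer_succ_eval, ascPochhammer_succ_eval]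
    have h := (ascPochhammer_pos n x hx).le
    exact mul_le_mul ih (by linarith) (by positivity) (h.trans ih)

theorem struveCoeff_pos {ν : ℝ} (hν : -1 / 2 ≤ ν) (n : ℕ) : 0 < struveCoeff ν n := by
  unfold struveCoeff
  have := ascPochhammer_pos n (ν + 3 / 2) (by linarith)
  positivity

theorem differentiable_struveEntire (ν : ℝ) : Differentiable ℂ (struveEntire ν) := by
  have h : (Complex.regularizedHGFunSeries {1} {3 / 2, (ν : ℂ) + 3 / 2}).radius = ⊤ :=
    Complex.radius_regularizedHGFunSeries_eq_top (by simp)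
  have h2 := (Complex.regularizedHGFunSeries {1} {3 / 2, (ν : ℂ) + 3 / 2}).hasFPowerSeriesOnBall
    (by rw [h]; simp)
  rw [h] at h2
  have h3 : Differentiable ℂ (Complex.regularizedHGFun {1} {3 / 2, (ν : ℂ) + 3 / 2}) := fun z =>
    (h2.analyticAt_of_mem (by simp)).differentiableAt
  unfold struveEntire hypergeometric1F2
  fun_prop

theorem hasSum_struveEntire {ν : ℝ} (hν : -1 / 2 ≤ ν) (w : ℂ) :
    HasSum (fun n => (struveCoeff ν n : ℂ) * (-w) ^ n) (struveEntire ν w) := by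
  have hb : ∀ k : ℕ, (3 / 2 : ℂ) ≠ -k := by
    intro k h
    have := congrArg Complex.re h
    simp at this
    have := k.cast_nonneg (α := ℝ)
    linarith
  have hc : ∀ k : ℕ, (ν + 3 / 2 : ℂ) ≠ -k := by
    intro k h
    have := congrArg Complex.re h
    simp at this
    have := k.cast_nonneg (α := ℝ)
    linarith
  have h1 := hypergeometric1F2_eq_tsum 1 hb hc (-w / 4)
  have hs : Summable fun n => (struveCoeff ν n : ℂ) * (-w) ^ n := by
    refine .of_norm_bounded (NormedSpace.expSeries_div_summable ‖w‖) fun n => ?_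
    rw [norm_mul, norm_pow, norm_neg, Complex.norm_real,
      Real.norm_of_nonneg (struveCoeff_pos hν n).le, div_eq_inv_mul]
    gcongr
    unfold struveCoeff
    -- As ν + 3/2 ≥ 1, the Pochhammer symbol dominates n!, so the coefficient is at most 1/n!.
    have h1 : (n.factorial : ℝ) ≤ (ascPochhammer ℝ n).eval (ν + 3 / 2) := by
      rw [← ascPochhammer_eval_one ℝ n]
      exact ascPochhammer_eval_mono n one_pos (by linarith)
    have h2 : (n.factorial : ℝ) ≤ (2 * n + 1).factorial := by
      exact_mod_cast Nat.factorial_le (by lia)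
    have h3 : (0 : ℝ) < n.factorial := by positivity
    have h4 := ascPochhammer_pos n (ν + 3 / 2) (by linarith)
    rw [div_le_iff₀ (by positivity), inv_mul_eq_div, le_div_iff₀ h3]
    gcongr
  convert hs.hasSum using 1
  rw [struveEntire, h1]
  refine tsum_congr fun n => ?_
  have h3 := eval_ascPochhammer_three_half n
  have h4 : (ascPochhammer ℂ n).eval ((ν : ℂ) + 3 / 2) =
      ((ascPochhammer ℝ n).eval (ν + 3 / 2) : ℝ) := by
    rw [← eval_ascPochhammer_ofReal]; push_cast; rfl
  have h5 : (ascPochhammer ℝ n).eval (ν + 3 / 2) ≠ 0 :=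
    (ascPochhammer_pos n (ν + 3 / 2) (by linarith)).ne'
  rw [ascPochhammer_eval_one, h4, struveCoeff]
  push_cast
  rw [← h3]
  have h6 : (n.factorial : ℂ) ≠ 0 := by exact_mod_cast n.factorial_ne_zero
  have h7 : (((ascPochhammer ℝ n).eval (ν + 3 / 2) : ℝ) : ℂ) ≠ 0 := by exact_mod_cast h5
  have h8 : (ascPochhammer ℂ n).eval (3 / 2 : ℂ) ≠ 0 := by
    intro h
    rw [h, zero_mul] at h3
    exact (by exact_mod_cast (2 * n + 1).factorial_ne_zero : ((2 * n + 1).factorial : ℂ) ≠ 0) h3.symm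
  rw [div_pow]
  field_simp

theorem struveEntire_ofReal {ν : ℝ} (hν : -1 / 2 ≤ ν) (x : ℝ) :
    struveEntire ν x = (struveEntire ν x).re := by
  have h := hasSum_struveEntire hν x
  have h2 := Complex.hasSum_conj'.2 h |>.unique (a₁ := _) (a₂ := struveEntire ν x) (by
    convert h using 2 with n
    simp)
  exact (Complex.conj_eq_iff_re.1 h2).symm

theorem struveEntire_neg_pos {ν : ℝ} (hν : -1 / 2 ≤ ν) {x : ℝ} (hx : x ≤ 0) :
    0 ≤ (struveEntire ν x).re := by
  have h := Complex.hasSum_re (hasSum_struveEntire hν x)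
  refine h.nonneg fun n => ?_
  have := struveCoeff_pos hν n
  have h1 : ((struveCoeff ν n : ℂ) * (-(x : ℂ)) ^ n) = ((struveCoeff ν n * (-x) ^ n : ℝ) : ℂ) := by
    push_cast; rfl
  rw [h1, Complex.ofReal_re]
  have : 0 ≤ -x := by linarith
  positivity

theorem struveCoeff_neg_half (n : ℕ) : struveCoeff (-1 / 2) n = ((2 * n + 1).factorial : ℝ)⁻¹ := by
  unfold struveCoeff
  rw [show (-1 / 2 + 3 / 2 : ℝ) = 1 by norm_num, ascPochhammer_eval_one]
  field_simp

theorem mul_struveEntire_neg_half (z : ℂ) :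
    z * struveEntire (-1 / 2) (z ^ 2) = Complex.sin z := by
  refine ((hasSum_struveEntire le_rfl (z ^ 2)).mul_left z).unique ?_
  convert! Complex.hasSum_sin z using 2 with n
  rw [struveCoeff_neg_half, neg_pow]
  push_cast
  ring

theorem struveCoeff_half (n : ℕ) : struveCoeff (1 / 2) n = 2 / ((2 * n + 2).factorial : ℝ) := by
  have h : (ascPochhammer ℝ n).eval 2 = (n + 1).factorial := by
    induction n with
    | zero => simp
    | succ n ih =>
      rw [ascPochhammer_succ_eval, ih, Nat.factorial_succ (n + 1)]
      push_cast
      ring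
  unfold struveCoeff
  rw [show (1 / 2 + 3 / 2 : ℝ) = 2 by norm_num, h, Nat.factorial_succ n,
    Nat.factorial_succ (2 * n + 1)]
  have : (n.factorial : ℝ) ≠ 0 := by positivity
  push_cast
  field_simp
  ring

theorem sq_mul_struveEntire_half (z : ℂ) :
    z ^ 2 * struveEntire (1 / 2) (z ^ 2) = 2 * (1 - Complex.cos z) := by
  have h := (Complex.hasSum_cos z).mul_left (-2)
  rw [← hasSum_nat_add_iff' 1] at h
  have h2 := (hasSum_struveEntire (by norm_num) (z ^ 2) (ν := 1 / 2)).mul_left (z ^ 2)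
  have h3 : -2 * Complex.cos z - ∑ i ∈ Finset.range 1,
      -2 * ((-1) ^ i * z ^ (2 * i) / ((2 * i).factorial : ℂ)) = 2 * (1 - Complex.cos z) := by
    simp
    ring
  rw [h3] at h
  refine h2.unique ?_
  convert! h using 2 with n
  rw [struveCoeff_half, neg_pow, show 2 * (n + 1) = 2 * n + 2 by ring]
  push_cast
  ring

/-! ### Euler's product and the end cases ν = ±1/2 -/

theorem sinZeroSq_ge (n : ℕ) : ((n : ℝ) + 1) ^ 2 ≤ sinZeroSq n := by
  unfold sinZeroSq
  rw [mul_pow]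
  have h : (1 : ℝ) ≤ Real.pi ^ 2 := by nlinarith [Real.pi_gt_three]
  nlinarith [sq_nonneg ((n : ℝ) + 1)]

theorem summable_inv_sinZeroSq : Summable fun n => (sinZeroSq n)⁻¹ := by
  have h : Summable fun n : ℕ => (((n + 1 : ℕ) : ℝ) ^ 2)⁻¹ :=
    (summable_nat_add_iff 1).2 (Real.summable_nat_pow_inv.2 one_lt_two)
  refine .of_nonneg_of_le (fun n => (inv_pos.2 (sinZeroSq_pos n)).le) (fun n => ?_) h
  push_cast
  exact inv_anti₀ (by positivity) (sinZeroSq_ge n)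

theorem struveEntire_zero {ν : ℝ} (hν : -1 / 2 ≤ ν) : struveEntire ν 0 = 1 := by
  refine (hasSum_struveEntire hν 0).unique ?_
  convert! hasSum_ite_eq 0 (1 : ℂ) using 2 with n
  rcases n with _ | n
  · simp [struveCoeff]
  · simp

theorem exists_sq_eq (w : ℂ) : ∃ z : ℂ, z ^ 2 = w :=
  IsAlgClosed.exists_pow_nat_eq w two_pos

/-- Euler's product for the sine function, in the variable `w = z ^ 2`. -/
theorem tendsto_euler_prod (w : ℂ) :
    Tendsto (fun N => ∏ n ∈ Finset.range N, (1 - w / sinZeroSq n)) atTop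
      (𝓝 (struveEntire (-1 / 2) w)) := by
  obtain ⟨z, rfl⟩ := exists_sq_eq w
  rcases eq_or_ne z 0 with rfl | hz
  · simp [struveEntire_zero]
  have hpi : (Real.pi : ℂ) ≠ 0 := by exact_mod_cast Real.pi_ne_zero
  have h := tendsto_euler_sin_prod' (x := z / Real.pi) (by positivity)
  rw [mul_div_cancel₀ z hpi, ← mul_struveEntire_neg_half, mul_div_cancel_left₀ _ hz] at h
  refine h.congr fun N => Finset.prod_congr rfl fun n _ => ?_
  have : (n : ℂ) + 1 ≠ 0 := by exact_mod_cast n.succ_ne_zero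
  simp only [sineTerm, sinZeroSq]
  push_cast
  field_simp
  ring

/-- The M-test with ∑ 1/λ_n gives uniform convergence on compact sets; Euler's formula identifies
the limit pointwise. -/
theorem tendstoLocallyUniformlyOn_euler_prod :
    TendstoLocallyUniformlyOn (fun N (w : ℂ) => ∏ n ∈ Finset.range N, (1 - w / sinZeroSq n))
      (struveEntire (-1 / 2)) atTop Set.univ := by
  rw [tendstoLocallyUniformlyOn_iff_forall_isCompact isOpen_univ]
  intro K _ hK
  obtain ⟨M, hM⟩ := hK.isBounded.exists_norm_le
  have h := Summable.hasProdUniformlyOn_nat_one_add (f := fun n w => -(w / (sinZeroSq n : ℂ))) hK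
    (summable_inv_sinZeroSq.mul_left M)
    (Eventually.of_forall fun n w hw => by
      rw [norm_neg, norm_div, Complex.norm_real, Real.norm_of_nonneg (sinZeroSq_pos n).le,
        div_eq_mul_inv]
      exact mul_le_mul_of_nonneg_right (hM w hw) (inv_pos.2 (sinZeroSq_pos n)).le)
    (fun n => by fun_prop)
  have h2 := h.tendstoUniformlyOn_finsetRange
  refine (h2.congr_right fun w hw => ?_).congr (Eventually.of_forall fun N w hw => ?_)
  · refine tendsto_nhds_unique (h2.tendsto_at hw) ?_
    simpa only [← sub_eq_add_neg] using tendsto_euler_prod w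
  · simp only [← sub_eq_add_neg]

theorem aeval_posRootProd_map_range (f : ℕ → ℝ) (N : ℕ) (w : ℂ) :
    aeval w (posRootProd ((Multiset.range N).map f)) =
      ∏ n ∈ Finset.range N, (1 - (f n : ℂ) * w) := by
  rw [aeval_posRootProd, Multiset.map_map]
  rfl

theorem posRootLimit_neg_half : PosRootLimit (struveEntire (-1 / 2)) := by
  refine ⟨fun N => (Multiset.range N).map fun n => (sinZeroSq n)⁻¹, ?_, ?_⟩
  · intro N μ hμ
    obtain ⟨n, -, rfl⟩ := Multiset.mem_map.1 hμ
    exact inv_pos.2 (sinZeroSq_pos n)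
  · refine (tendstoLocallyUniformlyOn_euler_prod.mono (Set.subset_univ _)).congr ?_
    intro N w _
    simp only [aeval_posRootProd_map_range]
    refine Finset.prod_congr rfl fun n _ => ?_
    push_cast
    ring

/-- This is 1 - cos z = 2 sin²(z/2); it is the source of the double zeros at ν = 1/2. -/
theorem struveEntire_half (w : ℂ) :
    struveEntire (1 / 2) w = struveEntire (-1 / 2) (w / 4) ^ 2 := by
  obtain ⟨z, rfl⟩ := exists_sq_eq w
  rcases eq_or_ne z 0 with rfl | hz
  · rw [zero_pow two_ne_zero, zero_div, struveEntire_zero (by norm_num), struveEntire_zero le_rfl,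
      one_pow]
  have h1 := sq_mul_struveEntire_half z
  have h2 := mul_struveEntire_neg_half (z / 2)
  have h3 : Complex.cos z = 1 - 2 * Complex.sin (z / 2) ^ 2 := by
    have h := Complex.cos_two_mul (z / 2)
    rw [mul_div_cancel₀ z two_ne_zero, Complex.cos_sq'] at h
    rw [h]; ring
  rw [h3, ← h2, show (z / 2) ^ 2 = z ^ 2 / 4 by ring] at h1
  have hz2 : z ^ 2 ≠ 0 := pow_ne_zero 2 hz
  refine mul_left_cancel₀ hz2 (h1.trans ?_)
  ring

theorem posRootLimit_half : PosRootLimit (struveEntire (1 / 2)) := by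
  refine ⟨fun N => ((Multiset.range N).map fun n => (4 * sinZeroSq n)⁻¹) +
    (Multiset.range N).map fun n => (4 * sinZeroSq n)⁻¹, ?_, ?_⟩
  · intro N μ hμ
    rw [Multiset.mem_add, or_self] at hμ
    obtain ⟨n, -, rfl⟩ := Multiset.mem_map.1 hμ
    have := sinZeroSq_pos n
    positivity
  · have h1 := tendstoLocallyUniformlyOn_euler_prod.comp (t := sinPoleCompl) (fun w : ℂ => w / 4)
      (fun _ _ => Set.mem_univ _) (by fun_prop)
    have h2 : ContinuousOn (struveEntire (-1 / 2) ∘ fun w : ℂ => w / 4) sinPoleCompl := by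
      have := (differentiable_struveEntire (-1 / 2)).continuous
      exact (by fun_prop : Continuous fun w : ℂ => struveEntire (-1 / 2) (w / 4)).continuousOn
    have h3 := h1.mul₀ h1 h2 h2
    refine (h3.congr ?_).congr_right ?_
    · intro N w _
      simp only [posRootProd, Multiset.map_add, Multiset.prod_add, map_mul, Pi.mul_apply,
        Function.comp_apply]
      rw [← posRootProd, aeval_posRootProd_map_range]
      have : ∏ n ∈ Finset.range N, (1 - w / 4 / (sinZeroSq n : ℂ)) =
          ∏ n ∈ Finset.range N, (1 - (((4 * sinZeroSq n)⁻¹ : ℝ) : ℂ) * w) := by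
        refine Finset.prod_congr rfl fun n _ => ?_
        push_cast
        rw [mul_inv]
        ring
      rw [this]
    · intro w _
      rw [struveEntire_half, sq]
      rfl

/-! ### Integral representation for -1/2 < ν ≤ 1/2 -/

/-- The weight `(1 - t²) ^ (ν - 1/2)` of the integral representation of the Struve function. -/
def struveWeight (ν t : ℝ) : ℝ := (1 - t ^ 2) ^ (ν - 1 / 2)

theorem struveWeight_nonneg (ν : ℝ) {t : ℝ} (h0 : 0 ≤ t) (h1 : t ≤ 1) : 0 ≤ struveWeight ν t :=
  Real.rpow_nonneg (by nlinarith) _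

theorem struveWeight_pos (ν : ℝ) {t : ℝ} (h0 : 0 ≤ t) (h1 : t < 1) : 0 < struveWeight ν t :=
  Real.rpow_pos_of_pos (by nlinarith) _

@[fun_prop]
theorem measurable_struveWeight (ν : ℝ) : Measurable (struveWeight ν) := by
  unfold struveWeight
  fun_prop

theorem intervalIntegrable_struveWeight {ν : ℝ} (h0 : -1 / 2 < ν) (h1 : ν ≤ 1 / 2) :
    IntervalIntegrable (struveWeight ν) volume 0 1 := by
  have h : IntervalIntegrable (fun t : ℝ => (1 - t) ^ (ν - 1 / 2)) volume 0 1 := by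
    have := (intervalIntegral.intervalIntegrable_rpow' (a := 0) (b := 1) (r := ν - 1 / 2)
      (by linarith)).comp_sub_left 1
    simpa using this.symm
  refine h.mono_fun (by fun_prop) ?_
  rw [Set.uIoc_of_le zero_le_one, EventuallyLE]
  refine (ae_restrict_iff' measurableSet_Ioc).2 (Eventually.of_forall fun t ht => ?_)
  rw [Real.norm_of_nonneg (struveWeight_nonneg ν ht.1.le ht.2),
    Real.norm_of_nonneg (Real.rpow_nonneg (by linarith [ht.2]) _)]
  rcases ht.2.eq_or_lt with rfl | hlt
  · simp [struveWeight]
  · exact Real.rpow_le_rpow_of_nonpos (by linarith) (by nlinarith [ht.1]) (by linarith)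

theorem IntervalIntegrable.struveWeight_mul {ν : ℝ} (h0 : -1 / 2 < ν) (h1 : ν ≤ 1 / 2)
    {g : ℝ → ℝ} (hg : Continuous g) :
    IntervalIntegrable (fun t => struveWeight ν t * g t) volume 0 1 :=
  (intervalIntegrable_struveWeight h0 h1).mul_continuousOn hg.continuousOn

/-- The odd moments of the weight. -/
def struveMoment (ν : ℝ) (n : ℕ) : ℝ := ∫ t in (0 : ℝ)..1, struveWeight ν t * t ^ (2 * n + 1)

theorem hasDerivAt_one_sub_sq_rpow (r : ℝ) {t : ℝ} (h0 : 0 ≤ t) (h1 : t < 1) :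
    HasDerivAt (fun t : ℝ => (1 - t ^ 2) ^ r) (-(2 * r * t * (1 - t ^ 2) ^ (r - 1))) t := by
  have h : 1 - t ^ 2 ≠ 0 := by nlinarith
  have h2 := (((hasDerivAt_id t).pow 2).const_sub 1).rpow_const (p := r) (Or.inl h)
  convert! h2 using 1
  simp only [Pi.pow_apply, id_eq]
  push_cast
  ring

/-- Integrate the derivative of t^(2n+2) (1 - t²)^(ν+1/2), which vanishes at both ends because ν +
1/2 > 0. -/
theorem struveMoment_succ {ν : ℝ} (h0 : -1 / 2 < ν) (h1 : ν ≤ 1 / 2) (n : ℕ) :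
    (n + ν + 3 / 2) * struveMoment ν (n + 1) = (n + 1) * struveMoment ν n := by
  have i1 := IntervalIntegrable.struveWeight_mul h0 h1 (continuous_pow (2 * n + 1))
  have i2 := IntervalIntegrable.struveWeight_mul h0 h1 (continuous_pow (2 * (n + 1) + 1))
  have key := intervalIntegral.integral_eq_sub_of_hasDerivAt_of_le
    (f := fun t : ℝ => t ^ (2 * n + 2) * (1 - t ^ 2) ^ (ν + 1 / 2)) (a := 0) (b := 1)
    (f' := fun t => (2 * n + 2) * (struveWeight ν t * t ^ (2 * n + 1)) -
      (2 * n + 2 * ν + 3) * (struveWeight ν t * t ^ (2 * (n + 1) + 1)))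
    zero_le_one ?_ ?_ ((i1.const_mul _).sub (i2.const_mul _))
  · rw [intervalIntegral.integral_sub (i1.const_mul _) (i2.const_mul _),
      intervalIntegral.integral_const_mul, intervalIntegral.integral_const_mul] at key
    have e : (1 - (1 : ℝ) ^ 2) ^ (ν + 1 / 2) = 0 := by
      rw [one_pow, sub_self, Real.zero_rpow (by linarith)]
    rw [e] at key
    simp only [ne_eq, Nat.add_eq_zero_iff, OfNat.ofNat_ne_zero, and_false, not_false_eq_true,
      zero_pow, zero_mul, mul_zero, sub_zero] at key
    unfold struveMoment
    linarith
  · refine Continuous.continuousOn (Continuous.mul (by fun_prop) ?_)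
    exact (by fun_prop : Continuous fun t : ℝ => 1 - t ^ 2).rpow_const fun _ => Or.inr (by linarith)
  · intro t ht
    have h2 := ((hasDerivAt_pow (2 * n + 2) t).mul
      (hasDerivAt_one_sub_sq_rpow (ν + 1 / 2) ht.1.le ht.2))
    convert! h2 using 1
    have h3 : 0 < 1 - t ^ 2 := by nlinarith [ht.1, ht.2]
    have e1 : (1 - t ^ 2) ^ (ν + 1 / 2) = (1 - t ^ 2) * struveWeight ν t := by
      rw [struveWeight, ← Real.rpow_one_add' h3.le (by linarith)]
      congr 1; ring
    have e2 : (1 - t ^ 2) ^ (ν + 1 / 2 - 1) = struveWeight ν t := by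
      rw [struveWeight]; congr 1; ring
    rw [e1, e2]
    simp only [Nat.add_one_sub_one, Nat.cast_add, Nat.cast_mul, Nat.cast_ofNat]
    ring

theorem struveMoment_eq {ν : ℝ} (h0 : -1 / 2 < ν) (h1 : ν ≤ 1 / 2) (n : ℕ) :
    struveMoment ν n = struveMoment ν 0 * struveCoeff ν n * (2 * n + 1).factorial := by
  induction n with
  | zero => simp [struveCoeff]
  | succ n ih =>
    have h := struveMoment_succ h0 h1 n
    have h2 : (n : ℝ) + ν + 3 / 2 ≠ 0 := by
      have := n.cast_nonneg (α := ℝ)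
      linarith
    have h3 := (ascPochhammer_pos n (ν + 3 / 2) (by linarith)).ne'
    rw [ih] at h
    refine mul_left_cancel₀ h2 (h.trans ?_)
    unfold struveCoeff
    rw [ascPochhammer_succ_eval, Nat.factorial_succ n, show ν + 3 / 2 + n = n + ν + 3 / 2 by ring]
    have h5 : ((2 * n + 1).factorial : ℝ) ≠ 0 := by positivity
    have h6 : ((2 * (n + 1) + 1).factorial : ℝ) ≠ 0 := by positivity
    generalize (n : ℝ) + ν + 3 / 2 = D at h2 ⊢
    push_cast
    field_simp

theorem struveMoment_zero_pos {ν : ℝ} (h0 : -1 / 2 < ν) (h1 : ν ≤ 1 / 2) :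
    0 < struveMoment ν 0 := by
  refine intervalIntegral.intervalIntegral_pos_of_pos_on
    (IntervalIntegrable.struveWeight_mul h0 h1 (continuous_pow _)) (fun t ht => ?_) zero_lt_one
  exact mul_pos (struveWeight_pos ν ht.1.le ht.2) (pow_pos ht.1 _)

/-- The finite sine transform of the weight. -/
def struveSine (ν : ℝ) (z : ℂ) : ℂ := ∫ t in (0 : ℝ)..1, (struveWeight ν t : ℂ) * Complex.sin (z * t)

/-- Termwise integration against the weight of a series with summable uniform bounds. -/
theorem hasSum_integral_struveWeight {ν : ℝ} (h0 : -1 / 2 < ν) (h1 : ν ≤ 1 / 2)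
    {g : ℕ → ℝ → ℂ} {G : ℝ → ℂ} {u : ℕ → ℝ} (hu : Summable u) (hg : ∀ n, Continuous (g n))
    (hb : ∀ n, ∀ t ∈ Set.Ioc (0 : ℝ) 1, ‖g n t‖ ≤ u n)
    (hG : ∀ t ∈ Set.Ioc (0 : ℝ) 1, HasSum (fun n => g n t) (G t)) :
    HasSum (fun n => ∫ t in (0 : ℝ)..1, (struveWeight ν t : ℂ) * g n t)
      (∫ t in (0 : ℝ)..1, (struveWeight ν t : ℂ) * G t) := by
  have hI : Set.uIoc (0 : ℝ) 1 = Set.Ioc 0 1 := Set.uIoc_of_le zero_le_one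
  refine intervalIntegral.hasSum_integral_of_dominated_convergence
    (fun n t => struveWeight ν t * u n) (fun n => ?_) (fun n => ?_) ?_ ?_ ?_
  · have := (hg n).measurable
    exact (by fun_prop : Measurable fun t => (struveWeight ν t : ℂ) * g n t).aestronglyMeasurable
  · refine Eventually.of_forall fun t ht => ?_
    rw [hI] at ht
    have := struveWeight_nonneg ν ht.1.le ht.2
    rw [norm_mul, Complex.norm_real, Real.norm_of_nonneg this]
    exact mul_le_mul_of_nonneg_left (hb n t ht) this
  · exact Eventually.of_forall fun t _ => hu.mul_left _
  · simp_rw [tsum_mul_left]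
    exact (intervalIntegrable_struveWeight h0 h1).mul_const _
  · refine Eventually.of_forall fun t ht => ?_
    rw [hI] at ht
    exact (hG t ht).mul_left _

/-- Integrate the sine series termwise; the moment recursion makes the odd moments match the
hypergeometric coefficients. -/
theorem struveSine_eq {ν : ℝ} (h0 : -1 / 2 < ν) (h1 : ν ≤ 1 / 2) (z : ℂ) :
    struveSine ν z = struveMoment ν 0 * (z * struveEntire ν (z ^ 2)) := by
  have hu : Summable fun n : ℕ => ‖z‖ ^ (2 * n + 1) / (2 * n + 1).factorial :=
    (Real.summable_pow_div_factorial ‖z‖).comp_injective (i := fun n : ℕ => 2 * n + 1)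
      fun a b h => by simpa using h
  have h := hasSum_integral_struveWeight h0 h1 (G := fun t => Complex.sin (z * t))
    (g := fun n t => (-1) ^ n * (z * t) ^ (2 * n + 1) / (2 * n + 1).factorial) hu
    (fun n => by fun_prop) (fun n t ht => by
      rw [norm_div, norm_mul, norm_pow, norm_pow, norm_neg, norm_one, one_pow, one_mul, norm_mul,
        Complex.norm_real, Real.norm_of_nonneg ht.1.le, Complex.norm_natCast]
      gcongr
      · have := ht.1
        positivity
      · exact mul_le_of_le_one_right (norm_nonneg z) ht.2)
    (fun t _ => Complex.hasSum_sin _)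
  refine h.unique ?_
  convert! ((hasSum_struveEntire h0.le (z ^ 2)).mul_left z).mul_left (struveMoment ν 0 : ℂ)
    using 2 with n
  have e : ∀ t : ℝ, (struveWeight ν t : ℂ) * ((-1) ^ n * (z * t) ^ (2 * n + 1) /
      (2 * n + 1).factorial) = ((-1) ^ n * z ^ (2 * n + 1) / (2 * n + 1).factorial) *
      ((struveWeight ν t * t ^ (2 * n + 1) : ℝ) : ℂ) := by
    intro t
    push_cast
    ring
  simp_rw [e]
  rw [intervalIntegral.integral_const_mul, intervalIntegral.integral_ofReal, ← struveMoment,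
    struveMoment_eq h0 h1 n, neg_pow]
  have h5 : ((2 * n + 1).factorial : ℂ) ≠ 0 := by exact_mod_cast (2 * n + 1).factorial_ne_zero
  push_cast
  field_simp
  ring

/-- The sign of the sine transform at the zeros of the sine function. -/
theorem struveWeight_integral_sin_pos {ν : ℝ} (h0 : -1 / 2 < ν) (h1 : ν < 1 / 2) (n : ℕ) :
    0 < ∫ t in (0 : ℝ)..1, struveWeight ν t * Real.sin ((n + 1) * Real.pi * (1 - t)) := by
  set c : ℝ := (n + 1) * Real.pi with hc
  have hcpos : 0 < c := by positivity
  have hcos : Continuous fun t : ℝ => t * (1 - Real.cos (c * (1 - t))) := by fun_prop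
  have i1 := IntervalIntegrable.struveWeight_mul h0 h1.le (g := fun t => Real.sin (c * (1 - t)))
    (by fun_prop)
  have i2 := hcos.intervalIntegrable (μ := volume) 0 1
  have hpos : 0 < ∫ t in (0 : ℝ)..1, t * (1 - Real.cos (c * (1 - t))) := by
    -- The witness t is chosen with c(1 - t) = π/2, so the cosine vanishes and the integrand equals
    -- t > 0.
    refine intervalIntegral.integral_pos zero_lt_one hcos.continuousOn
      (fun t ht => mul_nonneg ht.1.le (by linarith [Real.cos_le_one (c * (1 - t))]))
      ⟨1 - 1 / (2 * (n + 1)), ⟨?_, ?_⟩, ?_⟩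
    · rw [sub_nonneg, div_le_one (by positivity)]
      linarith [n.cast_nonneg (α := ℝ)]
    · simp only [sub_le_self_iff]
      positivity
    · have e : c * (1 - (1 - 1 / (2 * (n + 1)))) = Real.pi / 2 := by
        rw [hc]; field_simp; ring
      rw [e, Real.cos_pi_div_two, sub_zero, mul_one, sub_pos, div_lt_one (by positivity)]
      linarith [n.cast_nonneg (α := ℝ)]
  -- An integration by parts stated as an inequality. Here g = -(1 - t²)^(ν-1/2) (1 - cos c(1 - t)),
  -- written with sinc so that continuity at t = 1 is visible. In g' the singular factor (1 -
  -- t²)^(ν-3/2) ≥ 1 is replaced by 1, which gives the integrable majorant φ. As g(1) = 0 and g(0) ≤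
  -- 0, c times the integral is at least (1 - 2ν) ∫ t (1 - cos c(1 - t)) > 0.
  have key := intervalIntegral.sub_le_integral_of_hasDeriv_right_of_le (a := (0 : ℝ)) (b := 1)
    (g := fun t => -((1 - t ^ 2) ^ (ν + 3 / 2) *
      (2 * ((c / 2) * Real.sinc (c * (1 - t) / 2)) ^ 2 / (1 + t) ^ 2)))
    (g' := fun t => -(-(2 * (ν - 1 / 2) * t * (1 - t ^ 2) ^ (ν - 1 / 2 - 1)) *
      (1 - Real.cos (c * (1 - t))) + struveWeight ν t * (-(c * Real.sin (c * (1 - t))))))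
    (φ := fun t => c * (struveWeight ν t * Real.sin (c * (1 - t))) -
      (1 - 2 * ν) * (t * (1 - Real.cos (c * (1 - t))))) zero_le_one ?_ ?_ ?_ ?_
  · rw [intervalIntegral.integral_sub (i1.const_mul _) (i2.const_mul _),
      intervalIntegral.integral_const_mul, intervalIntegral.integral_const_mul] at key
    have e : (1 - (1 : ℝ) ^ 2) ^ (ν + 3 / 2) = 0 := by
      rw [one_pow, sub_self, Real.zero_rpow (by linarith)]
    rw [e] at key
    have h2 : 0 ≤ (1 - (0 : ℝ) ^ 2) ^ (ν + 3 / 2) *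
      (2 * ((c / 2) * Real.sinc (c * (1 - 0) / 2)) ^ 2 / (1 + 0) ^ 2) := by
      simp only [ne_eq, OfNat.ofNat_ne_zero, not_false_eq_true, zero_pow, sub_zero, Real.one_rpow]
      positivity
    have h3 : 0 < (1 - 2 * ν) * ∫ t in (0 : ℝ)..1, t * (1 - Real.cos (c * (1 - t))) :=
      mul_pos (by linarith) hpos
    refine pos_of_mul_pos_right (a := c) ?_ hcpos.le
    linarith
  · refine ContinuousOn.neg (ContinuousOn.mul (Continuous.continuousOn ?_) ?_)
    · exact (by fun_prop : Continuous fun t : ℝ => 1 - t ^ 2).rpow_const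
        fun _ => Or.inr (by linarith)
    · have := Real.continuous_sinc
      refine ContinuousOn.div (by fun_prop) (by fun_prop) fun t ht => ?_
      have := ht.1
      positivity
  · intro t ht
    have h2 : HasDerivAt (fun t : ℝ => 1 - Real.cos (c * (1 - t)))
        (-(c * Real.sin (c * (1 - t)))) t := by
      have := ((((hasDerivAt_id t).const_sub 1).const_mul c).cos).const_sub 1
      convert! this using 1
      simp
      ring
    have h3 := ((hasDerivAt_one_sub_sq_rpow (ν - 1 / 2) ht.1.le ht.2).mul h2).neg
    refine (h3.congr_of_eventuallyEq ?_).hasDerivWithinAt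
    filter_upwards [Ioo_mem_nhds ht.1 ht.2] with x hx
    have hx1 : 0 < 1 - x := by linarith [hx.2]
    have hx2 : 0 < 1 + x := by linarith [hx.1]
    have hx3 : 0 < 1 - x ^ 2 := by nlinarith
    have e1 : (1 - x ^ 2) ^ (ν + 3 / 2) = (1 - x ^ 2) ^ 2 * (1 - x ^ 2) ^ (ν - 1 / 2) := by
      rw [← Real.rpow_natCast (1 - x ^ 2) 2, ← Real.rpow_add hx3]
      congr 1
      push_cast
      ring
    have e2 : Real.cos (c * (1 - x)) = 1 - 2 * Real.sin (c * (1 - x) / 2) ^ 2 := by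
      have h := Real.cos_two_mul (c * (1 - x) / 2)
      rw [mul_div_cancel₀ _ two_ne_zero, Real.cos_sq'] at h
      rw [h]; ring
    simp only [Pi.neg_apply, Pi.mul_apply]
    rw [e1, e2, Real.sinc_of_ne_zero (by positivity)]
    have : (1 - x ^ 2) = (1 - x) * (1 + x) := by ring
    field_simp
    rw [this]
    ring
  · rw [← intervalIntegrable_iff_integrableOn_Icc_of_le zero_le_one]
    exact (i1.const_mul _).sub (i2.const_mul _)
  · intro t ht
    have hx3 : 0 < 1 - t ^ 2 := by nlinarith [ht.1, ht.2]
    have h4 : 1 ≤ (1 - t ^ 2) ^ (ν - 1 / 2 - 1) :=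
      Real.one_le_rpow_of_pos_of_le_one_of_nonpos hx3 (by nlinarith [ht.1]) (by linarith)
    have h5 : 0 ≤ (1 - 2 * ν) * (t * (1 - Real.cos (c * (1 - t)))) :=
      mul_nonneg (by linarith) (mul_nonneg ht.1.le (by linarith [Real.cos_le_one (c * (1 - t))]))
    have h6 := mul_le_mul_of_nonneg_left h4 h5
    linarith

/-! ### Partial fractions from a Fourier series -/

/-- Near a point off the poles, the distance to the poles is comparable with their size. -/
theorem exists_pole_bound {w : ℂ} (hw : w ∈ sinPoleCompl) : ∃ C r : ℝ, 0 < r ∧ 0 < C ∧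
    ∀ w' ∈ Metric.ball w r, ∀ n, sinZeroSq n ≤ C * ‖(sinZeroSq n : ℂ) - w'‖ := by
  obtain ⟨r, hr, hball⟩ := Metric.isOpen_iff.1 isOpen_sinPoleCompl w hw
  refine ⟨1 + (‖w‖ + r) / (r / 2), r / 2, half_pos hr, by positivity, fun w' hw' n => ?_⟩
  have h1 : r / 2 ≤ ‖(sinZeroSq n : ℂ) - w'‖ := by
    by_contra! hlt
    have : (sinZeroSq n : ℂ) ∈ Metric.ball w r := by
      rw [Metric.mem_ball] at hw' ⊢
      have := dist_triangle (sinZeroSq n : ℂ) w' w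
      rw [dist_eq_norm (sinZeroSq n : ℂ) w'] at this
      linarith
    exact hball this ⟨n, rfl⟩
  have h2 : ‖w'‖ ≤ ‖w‖ + r := by
    rw [Metric.mem_ball, dist_eq_norm] at hw'
    have := norm_le_norm_add_norm_sub' w' w
    linarith
  have h3 : sinZeroSq n ≤ ‖(sinZeroSq n : ℂ) - w'‖ + ‖w'‖ := by
    have := norm_le_norm_sub_add (sinZeroSq n : ℂ) w'
    rwa [Complex.norm_real, Real.norm_of_nonneg (sinZeroSq_pos n).le] at this
  have h4 : ‖w‖ + r ≤ (‖w‖ + r) / (r / 2) * ‖(sinZeroSq n : ℂ) - w'‖ := by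
    rw [div_mul_eq_mul_div, le_div_iff₀ (half_pos hr)]
    gcongr
  linarith

theorem inv_pole_le {C : ℝ} {w : ℂ} (hC : 0 < C) (n : ℕ)
    (h : sinZeroSq n ≤ C * ‖(sinZeroSq n : ℂ) - w‖) :
    ‖(sinZeroSq n : ℂ) - w‖⁻¹ ≤ C * (sinZeroSq n)⁻¹ := by
  have h1 := sinZeroSq_pos n
  have h2 : 0 < ‖(sinZeroSq n : ℂ) - w‖ := pos_of_mul_pos_right (h1.trans_le h) hC.le
  rw [inv_eq_one_div, div_le_iff₀ h2, mul_assoc, mul_comm, mul_assoc, inv_mul_eq_div,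
    le_div_iff₀ h1, one_mul, mul_comm]
  exact h

theorem cos_int_mul_pi_complex (n : ℤ) : Complex.cos (n * Real.pi) = (-1) ^ n := by
  have h := Real.cos_int_mul_pi n
  have h2 := congrArg (fun x : ℝ => (x : ℂ)) h
  push_cast at h2
  exact h2

theorem sin_int_mul_pi_complex (n : ℤ) : Complex.sin (n * Real.pi) = 0 := by
  have h := Real.sin_int_mul_pi n
  have h2 := congrArg (fun x : ℝ => (x : ℂ)) h
  push_cast at h2
  exact h2

theorem integral_exp_mul_I {a : ℂ} (ha : a ≠ 0) :
    ∫ t in (-1 : ℝ)..1, Complex.exp (a * Complex.I * t) = 2 * Complex.sin a / a := by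
  rw [integral_exp_mul_complex (mul_ne_zero ha Complex.I_ne_zero)]
  push_cast
  rw [mul_neg_one, mul_one, Complex.sin, ← neg_mul]
  field_simp
  rw [Complex.I_sq]
  ring

theorem sub_int_mul_pi_ne_zero {z : ℂ} (hz : z ≠ 0) (hz2 : z ^ 2 ∈ sinPoleCompl) (n : ℤ) :
    z - n * Real.pi ≠ 0 := by
  intro h
  rw [sub_eq_zero] at h
  rcases eq_or_ne n 0 with rfl | hn
  · simp at h
    exact hz h
  · refine hz2 ⟨n.natAbs - 1, ?_⟩
    have h1 : ((n.natAbs - 1 : ℕ) : ℝ) + 1 = |(n : ℝ)| := by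
      have h2 : n.natAbs - 1 + 1 = n.natAbs := Nat.sub_add_cancel (Int.natAbs_pos.2 hn)
      rw [← Nat.cast_succ, Nat.succ_eq_add_one, h2, Nat.cast_natAbs, Int.cast_abs]
    simp only [sinZeroSq]
    rw [h1, mul_pow, sq_abs, h]
    push_cast
    ring

/-- The Fourier coefficients of `t ↦ cos (z t)` on `[-1, 1]`. -/
def cosCoeff (z : ℂ) (n : ℤ) : ℂ := (-1) ^ n * z * Complex.sin z / (z ^ 2 - (n * Real.pi) ^ 2)

theorem integral_exp_mul_cos {z : ℂ} (hz : z ≠ 0) (hz2 : z ^ 2 ∈ sinPoleCompl) (n : ℤ) :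
    ∫ t in (-1 : ℝ)..1, Complex.exp (-(n * Real.pi) * Complex.I * t) * Complex.cos (z * t) =
      2 * cosCoeff z n := by
  have h1 := sub_int_mul_pi_ne_zero hz hz2 n
  have h2 : -z - n * Real.pi ≠ 0 :=
    sub_int_mul_pi_ne_zero (neg_ne_zero.2 hz) (by rwa [neg_sq]) n
  have e : ∀ t : ℝ, Complex.exp (-(n * Real.pi) * Complex.I * t) * Complex.cos (z * t) =
      (1 / 2) * (Complex.exp ((z - n * Real.pi) * Complex.I * t) +
        Complex.exp ((-z - n * Real.pi) * Complex.I * t)) := by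
    intro t
    rw [Complex.cos, ← mul_div_assoc, mul_add, ← Complex.exp_add, ← Complex.exp_add]
    ring_nf
  simp_rw [e]
  rw [intervalIntegral.integral_const_mul, intervalIntegral.integral_add
    (Continuous.intervalIntegrable (by fun_prop) _ _)
    (Continuous.intervalIntegrable (by fun_prop) _ _), integral_exp_mul_I h1, integral_exp_mul_I h2,
    Complex.sin_sub, Complex.sin_sub, cos_int_mul_pi_complex, sin_int_mul_pi_complex,
    Complex.sin_neg, cosCoeff]
  have h3 : z ^ 2 - (n * Real.pi) ^ 2 = -((z - n * Real.pi) * (-z - n * Real.pi)) := by ring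
  rw [h3]
  field_simp
  ring

theorem summable_cosCoeff {z : ℂ} (hz2 : z ^ 2 ∈ sinPoleCompl) : Summable (cosCoeff z) := by
  obtain ⟨C, r, hr, hC, hb⟩ := exists_pole_bound hz2
  have hs : Summable fun n : ℕ => ‖z * Complex.sin z‖ * (C * (sinZeroSq n)⁻¹) :=
    (summable_inv_sinZeroSq.mul_left C).mul_left _
  have key : ∀ (n : ℕ) (m : ℤ), ((m : ℂ) * Real.pi) ^ 2 = sinZeroSq n →
      ‖cosCoeff z m‖ ≤ ‖z * Complex.sin z‖ * (C * (sinZeroSq n)⁻¹) := by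
    intro n m h
    rw [cosCoeff, h, mul_assoc, norm_div, norm_mul _ (z * _), norm_zpow, norm_neg, norm_one,
      one_zpow, one_mul, div_eq_mul_inv, norm_sub_rev]
    exact mul_le_mul_of_nonneg_left
      (inv_pole_le hC n (hb _ (Metric.mem_ball_self hr) n)) (norm_nonneg _)
  rw [summable_int_iff_summable_nat_and_neg]
  constructor <;> rw [← summable_nat_add_iff 1] <;>
    refine .of_norm_bounded hs fun n => key n _ ?_ <;> simp only [sinZeroSq] <;> push_cast <;> ring

/-- As cos(zt) is even in t, its 2-periodic extension from [-1, 1] is continuous. Its Fourier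
coefficients are absolutely summable, so the series converges to it at every point, the endpoints
included. -/
theorem hasSum_cosCoeff {z : ℂ} (hz : z ≠ 0) (hz2 : z ^ 2 ∈ sinPoleCompl) {t : ℝ}
    (ht : t ∈ Set.Icc (-1 : ℝ) 1) :
    HasSum (fun n : ℤ => cosCoeff z n * Complex.exp (n * Real.pi * Complex.I * t))
      (Complex.cos (z * t)) := by
  have : Fact ((0 : ℝ) < 2) := ⟨two_pos⟩
  set g : ℝ → ℂ := fun t => Complex.cos (z * t) with hg
  have hcont : Continuous (AddCircle.liftIco (2 : ℝ) (-1) g) := by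
    refine AddCircle.liftIco_continuous ?_ ?_
    · simp only [hg]
      norm_num
    · exact Continuous.continuousOn (by fun_prop)
  set G : C(AddCircle (2 : ℝ), ℂ) := ⟨_, hcont⟩ with hG
  have hcoe : ∀ x ∈ Set.Ico (-1 : ℝ) 1, G (x : AddCircle (2 : ℝ)) = g x := by
    intro x hx
    refine AddCircle.liftIco_coe_apply (p := (2 : ℝ)) (a := -1) (f := g) ?_
    norm_num
    exact hx
  have hcoeff : ∀ n, fourierCoeff G n = cosCoeff z n := by
    intro n
    have h := fourierCoeff_liftIco_eq (T := (2 : ℝ)) (a := -1) g n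
    change fourierCoeff (AddCircle.liftIco (2 : ℝ) (-1) g) n = _
    rw [h, fourierCoeffOn_eq_integral]
    have e1 : (-1 + 2 : ℝ) - -1 = 2 := by norm_num
    have e2 : (-1 + 2 : ℝ) = 1 := by norm_num
    have e3 : ∀ x : ℝ, fourier (-n) (x : AddCircle ((-1 + 2 : ℝ) - -1)) • g x =
        Complex.exp (-(n * Real.pi) * Complex.I * x) * Complex.cos (z * x) := by
      intro x
      rw [fourier_coe_apply, e1, smul_eq_mul, hg]
      congr 2
      push_cast
      ring
    simp_rw [e3]
    rw [e2, integral_exp_mul_cos hz hz2, Complex.real_smul]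
    push_cast
    ring
  have hsum : Summable (fourierCoeff G) := by
    rw [funext hcoeff]
    exact summable_cosCoeff hz2
  have h := has_pointwise_sum_fourier_series_of_summable hsum (t : AddCircle (2 : ℝ))
  have hval : G (t : AddCircle (2 : ℝ)) = Complex.cos (z * t) := by
    rcases ht.2.eq_or_lt with rfl | hlt
    · have e : ((1 : ℝ) : AddCircle (2 : ℝ)) = ((-1 : ℝ) : AddCircle (2 : ℝ)) := by
        have := AddCircle.coe_add_period (2 : ℝ) (-1)
        rw [← this]
        norm_num
      rw [e, hcoe (-1) (by norm_num)]
      simp [hg]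
    · exact hcoe t ⟨ht.1, hlt⟩
  rw [hval] at h
  convert! h using 2 with n
  rw [hcoeff, fourier_coe_apply, smul_eq_mul]
  congr 2
  push_cast
  ring

/-- Pair the frequencies n and -n; the constant term is sin z / z. -/
theorem hasSum_cos_series {z : ℂ} (hz : z ≠ 0) (hz2 : z ^ 2 ∈ sinPoleCompl) {t : ℝ}
    (ht : t ∈ Set.Icc (-1 : ℝ) 1) :
    HasSum (fun n : ℕ => 2 * cosCoeff z (n + 1) * Complex.cos ((n + 1) * Real.pi * t))
      (Complex.cos (z * t) - Complex.sin z / z) := by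
  have h := (hasSum_cosCoeff hz hz2 ht).nat_add_neg
  rw [← hasSum_nat_add_iff' 1] at h
  convert! h using 1
  · funext n
    have e : cosCoeff z (-((n + 1 : ℕ) : ℤ)) = cosCoeff z ((n + 1 : ℕ) : ℤ) := by
      simp only [cosCoeff, zpow_neg, ← inv_zpow, inv_neg, inv_one]
      push_cast
      rw [neg_mul, neg_sq]
    rw [e, Complex.cos]
    push_cast
    ring_nf
  · simp [cosCoeff]
    field_simp

/-- Integrate the cosine series over [0, t]. The point is to expand sin(zt) in sines of the
frequencies (n+1)π, at which the sign of `struveSine` is known. -/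
theorem hasSum_sin_series {z : ℂ} (hz : z ≠ 0) (hz2 : z ^ 2 ∈ sinPoleCompl) {t : ℝ}
    (ht : t ∈ Set.Ioc (0 : ℝ) 1) :
    HasSum (fun n : ℕ => 2 * cosCoeff z (n + 1) / ((n + 1) * Real.pi) *
      Complex.sin ((n + 1) * Real.pi * t)) (Complex.sin (z * t) / z - t * (Complex.sin z / z)) := by
  have hsum : Summable fun n : ℕ => ‖2 * cosCoeff z (n + 1)‖ := by
    have := ((summable_int_iff_summable_nat_and_neg.1 (summable_cosCoeff hz2)).1)
    have := ((summable_nat_add_iff 1).2 this).norm.mul_left 2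
    refine this.congr fun n => ?_
    rw [norm_mul]
    norm_num
  have hcosbound : ∀ x : ℝ, ‖Complex.cos x‖ ≤ 1 := by
    intro x
    rw [← Complex.ofReal_cos, Complex.norm_real]
    exact Real.abs_cos_le_one x
  have hI : Set.uIoc (0 : ℝ) t = Set.Ioc 0 t := Set.uIoc_of_le ht.1.le
  have hint : ∀ c : ℂ, c ≠ 0 → ∫ x in (0 : ℝ)..t, Complex.cos (c * x) = Complex.sin (c * t) / c := by
    intro c hc
    rw [integral_cos_mul_complex hc]
    simp
  have h := intervalIntegral.hasSum_integral_of_dominated_convergence (μ := volume)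
    (a := 0) (b := t)
    (F := fun (n : ℕ) (x : ℝ) => 2 * cosCoeff z (n + 1) * Complex.cos ((n + 1) * Real.pi * x))
    (f := fun x : ℝ => Complex.cos (z * x) - Complex.sin z / z)
    (fun n _ => ‖2 * cosCoeff z (n + 1)‖)
    (fun n => (by fun_prop : Continuous fun x : ℝ => 2 * cosCoeff z (n + 1) *
      Complex.cos ((n + 1) * Real.pi * x)).aestronglyMeasurable)
    (fun n => Eventually.of_forall fun x _ => by
      rw [norm_mul]
      refine mul_le_of_le_one_right (norm_nonneg _) ?_
      have := hcosbound ((n + 1) * Real.pi * x)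
      push_cast at this
      exact this)
    (Eventually.of_forall fun x _ => hsum) (by simp)
    (Eventually.of_forall fun x hx => by
      rw [hI] at hx
      exact hasSum_cos_series hz hz2 ⟨by linarith [hx.1], hx.2.trans ht.2⟩)
  convert! h using 1
  · funext n
    have hn : ((n : ℂ) + 1) * Real.pi ≠ 0 :=
      mul_ne_zero (by exact_mod_cast n.succ_ne_zero) (by exact_mod_cast Real.pi_ne_zero)
    rw [intervalIntegral.integral_const_mul, hint _ hn]
    ring
  · rw [intervalIntegral.integral_sub (Continuous.intervalIntegrable (by fun_prop) _ _)
      (by simp), hint z hz]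
    simp [mul_div_assoc]

theorem struveEntire_neg_half_ne_zero {w : ℂ} (hw : w ∈ sinPoleCompl) :
    struveEntire (-1 / 2) w ≠ 0 := by
  intro h
  obtain ⟨z, rfl⟩ := exists_sq_eq w
  rcases eq_or_ne z 0 with rfl | hz
  · rw [zero_pow two_ne_zero, struveEntire_zero le_rfl] at h
    exact one_ne_zero h
  have h2 := mul_struveEntire_neg_half z
  rw [h, mul_zero, eq_comm, Complex.sin_eq_zero_iff] at h2
  obtain ⟨k, hk⟩ := h2
  exact sub_int_mul_pi_ne_zero hz hw k (sub_eq_zero.2 hk)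

theorem mul_sin_eq (z : ℂ) : z * Complex.sin z = z ^ 2 * struveEntire (-1 / 2) (z ^ 2) := by
  rw [← mul_struveEntire_neg_half]; ring

/-- The residues in the partial fraction expansion of the quotient of the Struve function and the
sine function. -/
def struveResidue (ν : ℝ) (n : ℕ) : ℝ :=
  2 * (∫ t in (0 : ℝ)..1, struveWeight ν t * Real.sin ((n + 1) * Real.pi * (1 - t))) /
    ((n + 1) * Real.pi * struveMoment ν 0)

theorem struveResidue_pos {ν : ℝ} (h0 : -1 / 2 < ν) (h1 : ν < 1 / 2) (n : ℕ) :
    0 < struveResidue ν n := by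
  have := struveWeight_integral_sin_pos h0 h1 n
  have := struveMoment_zero_pos h0 h1.le
  unfold struveResidue
  positivity

theorem sin_mul_pi_mul_one_sub (n : ℕ) (t : ℝ) :
    Real.sin ((n + 1) * Real.pi * (1 - t)) = (-1) ^ n * Real.sin ((n + 1) * Real.pi * t) := by
  have h1 : Real.sin ((n + 1) * Real.pi) = 0 := by
    exact_mod_cast Real.sin_nat_mul_pi (n + 1)
  have h2 : Real.cos ((n + 1) * Real.pi) = (-1) ^ (n + 1) := by
    exact_mod_cast Real.cos_nat_mul_pi (n + 1)
  rw [mul_sub, mul_one, Real.sin_sub, h1, h2]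
  ring

theorem struveSine_sinZero (ν : ℝ) (n : ℕ) :
    struveSine ν ((n + 1) * Real.pi) = (((-1) ^ n *
      ∫ t in (0 : ℝ)..1, struveWeight ν t * Real.sin ((n + 1) * Real.pi * (1 - t)) : ℝ) : ℂ) := by
  rw [← intervalIntegral.integral_const_mul, ← intervalIntegral.integral_ofReal]
  refine intervalIntegral.integral_congr fun t _ => ?_
  rw [sin_mul_pi_mul_one_sub]
  have : ((-1 : ℂ) ^ n) * (-1) ^ n = 1 := by rw [← mul_pow]; simp
  push_cast
  linear_combination (-(struveWeight ν t : ℂ) * Complex.sin ((n + 1) * Real.pi * t)) * this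

/-- Partial fraction expansion of the Struve function divided by the sine function. -/
theorem hasSum_struveResidue {ν : ℝ} (h0 : -1 / 2 < ν) (h1 : ν ≤ 1 / 2) {w : ℂ}
    (hw : w ∈ sinPoleCompl) :
    HasSum (fun n => (struveResidue ν n : ℂ) * (w / (sinZeroSq n - w)))
      (struveEntire ν w / struveEntire (-1 / 2) w - 1) := by
  obtain ⟨z, rfl⟩ := exists_sq_eq w
  rcases eq_or_ne z 0 with rfl | hz
  · simp [struveEntire_zero, struveEntire_zero h0.le]
  have hS := struveEntire_neg_half_ne_zero hw
  have hM := struveMoment_zero_pos h0 h1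
  have hM' : (struveMoment ν 0 : ℂ) ≠ 0 := by exact_mod_cast hM.ne'
  have hsum : Summable fun n : ℕ => ‖2 * cosCoeff z (n + 1)‖ := by
    have := ((summable_int_iff_summable_nat_and_neg.1 (summable_cosCoeff hw)).1)
    have := ((summable_nat_add_iff 1).2 this).norm.mul_left 2
    refine this.congr fun n => ?_
    rw [norm_mul]
    norm_num
  -- Integrated against the weight, the sine series sums to M (q_ν - q_{-1/2}) with M =
  -- `struveMoment ν 0`, and its n-th term contains `struveSine` at (n+1)π. Division by M q_{-1/2}
  -- cancels the z sin z in `cosCoeff`, up to a factor z².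
  have h := hasSum_integral_struveWeight h0 h1
    (g := fun n t => 2 * cosCoeff z (n + 1) / ((n + 1) * Real.pi) *
      Complex.sin ((n + 1) * Real.pi * t)) hsum (fun n => by fun_prop) (fun n t _ => by
        have hs := Real.abs_sin_le_one ((n + 1) * Real.pi * t)
        rw [← Real.norm_eq_abs, ← Complex.norm_real] at hs
        push_cast at hs
        rw [norm_mul, norm_div]
        have hd : 1 ≤ ‖((n : ℂ) + 1) * Real.pi‖ := by
          have e : ((n : ℂ) + 1) * Real.pi = (((n + 1) * Real.pi : ℝ) : ℂ) := by push_cast; rfl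
          rw [e, Complex.norm_real, Real.norm_of_nonneg (by positivity)]
          nlinarith [Real.pi_gt_three, n.cast_nonneg (α := ℝ)]
        calc _ ≤ ‖2 * cosCoeff z (n + 1)‖ / ‖((n : ℂ) + 1) * Real.pi‖ * 1 := by gcongr
          _ ≤ _ := by rw [mul_one]; exact div_le_self (norm_nonneg _) hd)
    (fun t ht => hasSum_sin_series hz hw ht)
  have i1 : IntervalIntegrable (fun t : ℝ => (struveWeight ν t : ℂ) * (Complex.sin (z * t) / z))
      volume 0 1 := by
    have : IntervalIntegrable (fun t => (struveWeight ν t : ℂ)) volume 0 1 := by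
      have h := intervalIntegrable_struveWeight h0 h1
      exact ⟨h.1.ofReal, h.2.ofReal⟩
    exact this.mul_continuousOn (by fun_prop)
  have i2 : IntervalIntegrable (fun t : ℝ => (struveWeight ν t : ℂ) *
      (t * (Complex.sin z / z))) volume 0 1 := by
    have : IntervalIntegrable (fun t => (struveWeight ν t : ℂ)) volume 0 1 := by
      have h := intervalIntegrable_struveWeight h0 h1
      exact ⟨h.1.ofReal, h.2.ofReal⟩
    exact this.mul_continuousOn (by fun_prop)
  have e1 : ∫ t in (0 : ℝ)..1, (struveWeight ν t : ℂ) *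
      (Complex.sin (z * t) / z - t * (Complex.sin z / z)) =
      struveMoment ν 0 * (struveEntire ν (z ^ 2) - struveEntire (-1 / 2) (z ^ 2)) := by
    simp_rw [mul_sub]
    rw [intervalIntegral.integral_sub i1 i2]
    have a1 : ∫ t in (0 : ℝ)..1, (struveWeight ν t : ℂ) * (Complex.sin (z * t) / z) =
        struveMoment ν 0 * struveEntire ν (z ^ 2) := by
      simp_rw [← mul_div_assoc]
      rw [intervalIntegral.integral_div, ← struveSine, struveSine_eq h0 h1]
      field_simp
    have a2 : ∫ t in (0 : ℝ)..1, (struveWeight ν t : ℂ) * (t * (Complex.sin z / z)) =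
        struveMoment ν 0 * struveEntire (-1 / 2) (z ^ 2) := by
      simp_rw [← mul_assoc]
      rw [intervalIntegral.integral_mul_const, ← mul_struveEntire_neg_half, struveMoment,
        ← intervalIntegral.integral_ofReal]
      push_cast
      simp only [pow_one]
      field_simp
    rw [a1, a2]
  rw [e1] at h
  have hzS := mul_sin_eq z
  generalize struveEntire (-1 / 2) (z ^ 2) = S at hS h hzS ⊢
  convert! h.mul_right ((struveMoment ν 0 : ℂ) * S)⁻¹ using 1
  · funext n
    have e2 : ∫ t in (0 : ℝ)..1, (struveWeight ν t : ℂ) * (2 * cosCoeff z (n + 1) /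
        ((n + 1) * Real.pi) * Complex.sin ((n + 1) * Real.pi * t)) =
        2 * cosCoeff z (n + 1) / ((n + 1) * Real.pi) * struveSine ν ((n + 1) * Real.pi) := by
      rw [struveSine, ← intervalIntegral.integral_const_mul]
      refine intervalIntegral.integral_congr fun t _ => ?_
      ring
    have hn : (n : ℂ) + 1 ≠ 0 := by exact_mod_cast n.succ_ne_zero
    have hpi : (Real.pi : ℂ) ≠ 0 := by exact_mod_cast Real.pi_ne_zero
    have hd : (sinZeroSq n : ℂ) - z ^ 2 ≠ 0 := fun h => hw ⟨n, sub_eq_zero.1 h⟩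
    have hd' : z ^ 2 - (sinZeroSq n : ℂ) ≠ 0 := by rw [← neg_sub]; exact neg_ne_zero.2 hd
    have e3 : cosCoeff z (n + 1) = -((-1) ^ n * (z ^ 2 * S) / (z ^ 2 - sinZeroSq n)) := by
      rw [cosCoeff, mul_assoc, hzS, sinZeroSq, show ((n : ℤ) + 1) = ((n + 1 : ℕ) : ℤ) by
        push_cast; rfl, zpow_natCast, pow_succ]
      push_cast
      ring
    have e4 : ((-1 : ℂ) ^ n) * (-1) ^ n = 1 := by rw [← mul_pow]; simp
    have e5 : z ^ 2 / (sinZeroSq n - z ^ 2 : ℂ) = -(z ^ 2 / (z ^ 2 - sinZeroSq n)) := by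
      rw [← neg_sub, div_neg]
    rw [e2, struveSine_sinZero, e3, e5, struveResidue]
    push_cast
    generalize (∫ t in (0 : ℝ)..1, struveWeight ν t * Real.sin ((n + 1) * Real.pi * (1 - t))) = J
    field_simp
    linear_combination (J : ℂ) * e4
  · field_simp

theorem struveEntire_neg_half_re_pos {x : ℝ} (hx : x ≤ 0) :
    0 < (struveEntire (-1 / 2) x).re :=
  one_pos.trans_le (posRootLimit_neg_half.re_nonpos hx).1

theorem struveEntire_div_ofReal {ν : ℝ} (h0 : -1 / 2 < ν) (x : ℝ) :
    struveEntire ν x / struveEntire (-1 / 2) x - 1 =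
      (((struveEntire ν x).re / (struveEntire (-1 / 2) x).re - 1 : ℝ) : ℂ) := by
  rw [struveEntire_ofReal h0.le, struveEntire_ofReal le_rfl]
  push_cast
  rfl

theorem hasSum_struveResidue_real {ν : ℝ} (h0 : -1 / 2 < ν) (h1 : ν ≤ 1 / 2) {x : ℝ}
    (hx : (x : ℂ) ∈ sinPoleCompl) :
    HasSum (fun n => struveResidue ν n * (x / (sinZeroSq n - x)))
      ((struveEntire ν x).re / (struveEntire (-1 / 2) x).re - 1) := by
  have h := hasSum_struveResidue h0 h1 hx
  rw [struveEntire_div_ofReal h0] at h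
  rw [← Complex.hasSum_ofReal]
  convert! h using 2 with n
  push_cast
  rfl

/-- At w = -y the expansion equals q_ν/q_{-1/2} - 1 ≥ -1, because neither function is negative on
the negative axis; every term is ≤ 0 there and tends to -r_n as y → ∞. -/
theorem sum_struveResidue_lt_one {ν : ℝ} (h0 : -1 / 2 < ν) (h1 : ν < 1 / 2) (N : ℕ) :
    ∑ n ∈ Finset.range N, struveResidue ν n < 1 := by
  -- Strictness comes from the weak bound for N + 1 and the positivity of the extra residue.
  suffices h : ∀ N : ℕ, ∑ n ∈ Finset.range N, struveResidue ν n ≤ 1 by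
    have := h (N + 1)
    rw [Finset.sum_range_succ] at this
    linarith [struveResidue_pos h0 h1 N]
  intro N
  have hle : ∀ y : ℝ, 0 < y →
      ∑ n ∈ Finset.range N, struveResidue ν n * (y / (sinZeroSq n + y)) ≤ 1 := by
    intro y hy
    have hs := (hasSum_struveResidue_real h0 h1.le
      (mem_sinPoleCompl_of_nonpos (neg_nonpos.2 hy.le))).neg
    have hnn : ∀ n, 0 ≤ -(struveResidue ν n * (-y / (sinZeroSq n - -y))) := by
      intro n
      have := struveResidue_pos h0 h1 n
      have := sinZeroSq_pos n
      rw [sub_neg_eq_add, neg_div, mul_neg, neg_neg]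
      positivity
    have h := sum_le_hasSum (Finset.range N) (fun n _ => hnn n) hs
    have h2 : 0 ≤ (struveEntire ν ((-y : ℝ) : ℂ)).re /
        (struveEntire (-1 / 2) ((-y : ℝ) : ℂ)).re :=
      div_nonneg (struveEntire_neg_pos h0.le (neg_nonpos.2 hy.le))
        (struveEntire_neg_half_re_pos (neg_nonpos.2 hy.le)).le
    have h3 : ∑ n ∈ Finset.range N, struveResidue ν n * (y / (sinZeroSq n + y)) =
        ∑ n ∈ Finset.range N, -(struveResidue ν n * (-y / (sinZeroSq n - -y))) :=
      Finset.sum_congr rfl fun n _ => by rw [sub_neg_eq_add, neg_div, mul_neg, neg_neg]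
    linarith
  have hlim : Tendsto (fun y : ℝ => ∑ n ∈ Finset.range N,
      struveResidue ν n * (y / (sinZeroSq n + y))) atTop
      (𝓝 (∑ n ∈ Finset.range N, struveResidue ν n * 1)) := by
    refine tendsto_finsetSum _ fun n _ => Tendsto.const_mul _ ?_
    have h : Tendsto (fun y : ℝ => 1 - sinZeroSq n / (sinZeroSq n + y)) atTop (𝓝 (1 - 0)) :=
      tendsto_const_nhds.sub (Tendsto.div_atTop tendsto_const_nhds
        (tendsto_atTop_add_const_left _ _ tendsto_id))
    rw [sub_zero] at h
    refine h.congr' ?_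
    filter_upwards [eventually_gt_atTop 0] with y hy
    have := sinZeroSq_pos n
    field_simp
    ring
  simp only [mul_one] at hlim
  exact le_of_tendsto hlim (by filter_upwards [eventually_gt_atTop 0] with y hy using hle y hy)

theorem struveResidue_le_one {ν : ℝ} (h0 : -1 / 2 < ν) (h1 : ν < 1 / 2) (n : ℕ) :
    struveResidue ν n ≤ 1 :=
  (Finset.single_le_sum (fun i _ => (struveResidue_pos h0 h1 i).le)
    (Finset.self_mem_range_succ n)).trans (sum_struveResidue_lt_one h0 h1 (n + 1)).le

/-! ### Approximating polynomials for -1/2 < ν < 1/2 -/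

/-- A real polynomial with value `1` at `0`, all complex roots of which are positive real numbers,
is of the form `posRootProd s`. -/
theorem exists_eq_posRootProd {p : ℝ[X]} (hp : p.eval 0 = 1)
    (hroots : ∀ w : ℂ, aeval w p = 0 → w.im = 0 ∧ 0 < w.re) :
    ∃ s : Multiset ℝ, (∀ μ ∈ s, 0 < μ) ∧ ∀ w : ℂ, aeval w p = aeval w (posRootProd s) := by
  set P : ℂ[X] := p.map (algebraMap ℝ ℂ) with hP
  have hPe : ∀ w, P.eval w = aeval w p := fun w => by rw [hP, eval_map_algebraMap]
  have hsplit : P.Splits := IsAlgClosed.splits P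
  have hP0 : P.eval 0 = 1 := by
    rw [hPe]
    have := aeval_ofReal_eq p 0
    simpa [hp] using this
  have hPne : P ≠ 0 := by rintro h; simp [h] at hP0
  have hr : ∀ r ∈ P.roots, r.im = 0 ∧ 0 < r.re := fun r h =>
    hroots r (by rw [← hPe]; exact (mem_roots hPne).1 h)
  refine ⟨P.roots.map fun r => r.re⁻¹, ?_, fun w => ?_⟩
  · intro μ hμ
    obtain ⟨r, hr', rfl⟩ := Multiset.mem_map.1 hμ
    exact inv_pos.2 (hr r hr').2
  · have he : ∀ w, P.eval w = P.leadingCoeff * (P.roots.map fun r => w - r).prod := by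
      intro w
      conv_lhs => rw [hsplit.eq_prod_roots]
      simp [eval_multiset_prod]
    have h0 : P.leadingCoeff * (P.roots.map fun r => 0 - r).prod = 1 := by rw [← he, hP0]
    rw [← hPe, he, aeval_posRootProd, Multiset.map_map]
    have h1 : (P.roots.map fun r => w - r).prod = (P.roots.map fun r => 0 - r).prod *
        (P.roots.map ((fun μ : ℝ => 1 - (μ : ℂ) * w) ∘ fun r => r.re⁻¹)).prod := by
      rw [← Multiset.prod_map_mul]
      congr 1
      refine Multiset.map_congr rfl fun r hr' => ?_
      have h2 := hr r hr'
      have h3 : r = (r.re : ℂ) := by apply Complex.ext <;> simp [h2.1]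
      have h4 : (r.re : ℂ) ≠ 0 := by exact_mod_cast h2.2.ne'
      simp only [Function.comp_apply]
      push_cast
      conv_lhs => rw [h3]
      conv_rhs => rw [h3]
      simp only [Complex.ofReal_re]
      field_simp
      ring
    rw [h1, ← mul_assoc, h0, one_mul]

/-- The truncations of the product of the Euler product of the sine function and of the partial
fraction expansion. -/
def struvePoly (ν : ℝ) (N : ℕ) : ℝ[X] :=
  ∏ n ∈ Finset.range N, (1 - C (sinZeroSq n)⁻¹ * X) +
    ∑ n ∈ Finset.range N, C (struveResidue ν n * (sinZeroSq n)⁻¹) * X *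
      ∏ k ∈ (Finset.range N).erase n, (1 - C (sinZeroSq k)⁻¹ * X)

theorem eval_zero_struvePoly (ν : ℝ) (N : ℕ) : (struvePoly ν N).eval 0 = 1 := by
  simp [struvePoly, eval_prod, eval_finsetSum]

theorem aeval_struvePoly (ν : ℝ) (N : ℕ) {w : ℂ} (hw : w ∈ sinPoleCompl) :
    aeval w (struvePoly ν N) = (∏ n ∈ Finset.range N, (1 - w / sinZeroSq n)) *
      (1 + ∑ n ∈ Finset.range N, (struveResidue ν n : ℂ) * (w / (sinZeroSq n - w))) := by
  have hl : ∀ n, (sinZeroSq n : ℂ) ≠ 0 := fun n => by exact_mod_cast (sinZeroSq_pos n).ne'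
  have hd : ∀ n, (sinZeroSq n : ℂ) - w ≠ 0 := fun n h => hw ⟨n, sub_eq_zero.1 h⟩
  have hf : ∀ n, (aeval w) (1 - C (sinZeroSq n)⁻¹ * X) = 1 - w / sinZeroSq n := by
    intro n
    simp
    ring
  simp only [struvePoly, map_add, map_prod, map_sum, map_mul _ (_ * _), hf]
  rw [mul_add, mul_one, Finset.mul_sum]
  congr 1
  refine Finset.sum_congr rfl fun n hn => ?_
  rw [← Finset.mul_prod_erase _ _ hn]
  simp only [map_mul, aeval_C, aeval_X, Complex.coe_algebraMap]
  push_cast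
  have h1 := hl n
  have h2 := hd n
  field_simp

/-- A root at a pole is positive already. Elsewhere the bracket 1 + ∑ r_n w/(λ_n - w) must vanish.
Off the real axis all its terms have imaginary part of the sign of Im w. For x ≤ 0 each x/(λ_n - x)
is at least -1, and the residues sum to less than 1. -/
theorem struvePoly_roots {ν : ℝ} (h0 : -1 / 2 < ν) (h1 : ν < 1 / 2) (N : ℕ) {w : ℂ}
    (hw : aeval w (struvePoly ν N) = 0) : w.im = 0 ∧ 0 < w.re := by
  by_cases hV : w ∈ sinPoleCompl
  swap
  · obtain ⟨n, rfl⟩ := not_not.1 hV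
    simpa using sinZeroSq_pos n
  have hd : ∀ n, (sinZeroSq n : ℂ) - w ≠ 0 := fun n h => hV ⟨n, sub_eq_zero.1 h⟩
  have hl : ∀ n, (sinZeroSq n : ℂ) ≠ 0 := fun n => by exact_mod_cast (sinZeroSq_pos n).ne'
  rw [aeval_struvePoly ν N hV, mul_eq_zero, or_iff_right] at hw
  swap
  · rw [Finset.prod_eq_zero_iff]
    rintro ⟨n, -, h⟩
    apply hd n
    have h2 := hl n
    field_simp at h
    rw [h, mul_zero]
  have him : w.im = 0 := by
    by_contra hne
    have h3 : ∀ n, ((struveResidue ν n : ℂ) * (w / (sinZeroSq n - w))).im =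
        w.im * (struveResidue ν n * (sinZeroSq n / Complex.normSq (sinZeroSq n - w))) := by
      intro n
      have h4 : (struveResidue ν n : ℂ) * (w / (sinZeroSq n - w)) =
          ((-struveResidue ν n : ℝ) : ℂ) +
            ((struveResidue ν n * sinZeroSq n : ℝ) : ℂ) * (sinZeroSq n - w)⁻¹ := by
        have := hd n
        push_cast
        field_simp
        ring
      rw [h4, Complex.add_im, Complex.ofReal_im, Complex.im_ofReal_mul, Complex.inv_im]
      simp
      ring
    have h2 := congrArg Complex.im hw
    rw [Complex.add_im, Complex.im_sum, Finset.sum_congr rfl fun n _ => h3 n, ← Finset.mul_sum,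
      Complex.one_im, zero_add, Complex.zero_im, mul_eq_zero, or_iff_right hne] at h2
    rcases N.eq_zero_or_pos with rfl | hN
    · simp at hw
    · refine (Finset.sum_pos (fun n _ => ?_) (Finset.nonempty_range_iff.2 hN.ne')).ne' h2
      have := struveResidue_pos h0 h1 n
      have := sinZeroSq_pos n
      have := Complex.normSq_pos.2 (hd n)
      positivity
  refine ⟨him, ?_⟩
  by_contra! hre
  have hwx : w = (w.re : ℂ) := by apply Complex.ext <;> simp [him]
  rw [hwx] at hw
  generalize w.re = x at hre hw
  have hw' : 1 + ∑ n ∈ Finset.range N, struveResidue ν n * (x / (sinZeroSq n - x)) = 0 := by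
    exact_mod_cast hw
  have h2 : ∑ n ∈ Finset.range N, -struveResidue ν n ≤
      ∑ n ∈ Finset.range N, struveResidue ν n * (x / (sinZeroSq n - x)) := by
    refine Finset.sum_le_sum fun n _ => ?_
    have h3 := struveResidue_pos h0 h1 n
    have h4 := sinZeroSq_pos n
    have h5 : -1 ≤ x / (sinZeroSq n - x) := by
      rw [le_div_iff₀ (by linarith)]
      linarith
    nlinarith
  rw [Finset.sum_neg_distrib] at h2
  linarith [sum_struveResidue_lt_one h0 h1 N]

/-- The M-test: r_n ≤ 1, and near a point off the poles 1/|λ_n - w| is at most C/λ_n. -/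
theorem tendstoLocallyUniformlyOn_struveResidue {ν : ℝ} (h0 : -1 / 2 < ν) (h1 : ν < 1 / 2) :
    TendstoLocallyUniformlyOn (fun N w =>
      ∑ n ∈ Finset.range N, (struveResidue ν n : ℂ) * (w / (sinZeroSq n - w)))
      (fun w => struveEntire ν w / struveEntire (-1 / 2) w - 1) atTop sinPoleCompl := by
  have h : TendstoLocallyUniformlyOn (fun N w =>
      ∑ n ∈ Finset.range N, (struveResidue ν n : ℂ) * (w / (sinZeroSq n - w)))
      (fun w => ∑' n, (struveResidue ν n : ℂ) * (w / (sinZeroSq n - w))) atTop sinPoleCompl := by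
    intro u hu w hw
    obtain ⟨C, r, hr, hC, hb⟩ := exists_pole_bound hw
    refine ⟨Metric.ball w r, mem_nhdsWithin_of_mem_nhds (Metric.ball_mem_nhds w hr), ?_⟩
    have hs : Summable fun n => (‖w‖ + r) * (C * (sinZeroSq n)⁻¹) :=
      (summable_inv_sinZeroSq.mul_left C).mul_left _
    refine tendstoUniformlyOn_tsum_nat hs (fun n w' hw' => ?_) u hu
    have h2 : ‖w'‖ ≤ ‖w‖ + r := by
      rw [Metric.mem_ball, dist_eq_norm] at hw'
      have := norm_le_norm_add_norm_sub' w' w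
      linarith
    have h3 := struveResidue_pos h0 h1 n
    rw [norm_mul, Complex.norm_real, Real.norm_of_nonneg h3.le, norm_div, div_eq_mul_inv]
    refine (mul_le_of_le_one_left (by positivity) (struveResidue_le_one h0 h1 n)).trans ?_
    exact mul_le_mul h2 (inv_pole_le hC n (hb w' hw' n)) (by positivity) (by positivity)
  exact h.congr_right fun w hw => (hasSum_struveResidue h0 h1.le hw).tsum_eq

theorem posRootLimit_struveEntire_of_lt {ν : ℝ} (h0 : -1 / 2 < ν) (h1 : ν < 1 / 2) :
    PosRootLimit (struveEntire ν) := by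
  choose s hs hsp using fun N => exists_eq_posRootProd (eval_zero_struvePoly ν N)
    fun w hw => struvePoly_roots h0 h1 N hw
  refine ⟨s, hs, ?_⟩
  have c1 : ContinuousOn (struveEntire (-1 / 2)) sinPoleCompl :=
    (differentiable_struveEntire _).continuous.continuousOn
  have c2 : ContinuousOn (fun w => struveEntire ν w / struveEntire (-1 / 2) w) sinPoleCompl :=
    (differentiable_struveEntire _).continuous.continuousOn.div c1
      fun w hw => struveEntire_neg_half_ne_zero hw
  have hR : TendstoLocallyUniformlyOn (fun N w =>
      1 + ∑ n ∈ Finset.range N, (struveResidue ν n : ℂ) * (w / (sinZeroSq n - w)))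
      (fun w => struveEntire ν w / struveEntire (-1 / 2) w) atTop sinPoleCompl := by
    intro u hu w hw
    have := (tendstoLocallyUniformlyOn_struveResidue h0 h1)
    rw [Metric.tendstoLocallyUniformlyOn_iff] at this
    obtain ⟨ε, hε, hεu⟩ := Metric.mem_uniformity_dist.1 hu
    obtain ⟨t, ht, hev⟩ := this ε hε w hw
    refine ⟨t, ht, hev.mono fun N hN y hy => hεu ?_⟩
    have h2 := hN y hy
    rw [dist_eq_norm] at h2 ⊢
    convert h2 using 2
    ring
  have h := (tendstoLocallyUniformlyOn_euler_prod.mono (Set.subset_univ _)).mul₀ hR c1 c2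
  refine (h.congr fun N w hw => ?_).congr_right fun w hw => ?_
  · rw [← hsp, aeval_struvePoly ν N hw]
    rfl
  · exact mul_div_cancel₀ _ (struveEntire_neg_half_ne_zero hw)

theorem posRootLimit_struveEntire {ν : ℝ} (hν : |ν| ≤ 1 / 2) : PosRootLimit (struveEntire ν) := by
  obtain ⟨h0, h1⟩ := abs_le.1 hν
  rcases h1.eq_or_lt with rfl | h1
  · exact posRootLimit_half
  rcases h0.eq_or_lt with h0 | h0
  · rw [← h0, ← neg_div]
    exact posRootLimit_neg_half
  · exact posRootLimit_struveEntire_of_lt (by linarith) h1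

/-! ### Positive zeros of the entire factor and their order -/

/-- `x` enumerates increasingly the positive reals `t` with `q (t ^ 2) = 0`. -/
structure IsSqZeroSeq (q : ℂ → ℂ) (x : ℕ → ℝ) : Prop where
  pos : ∀ n, 0 < x n
  strictMono : StrictMono x
  tendsto : Tendsto x atTop atTop
  zero : ∀ n, q ((x n ^ 2 : ℝ) : ℂ) = 0
  exists_eq : ∀ t : ℝ, 0 < t → q ((t ^ 2 : ℝ) : ℂ) = 0 → ∃ n, t = x n

theorem tendsto_succ_mul_pi : Tendsto (fun n : ℕ => ((n : ℝ) + 1) * Real.pi) atTop atTop :=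
  (tendsto_atTop_add_const_right _ _ tendsto_natCast_atTop_atTop).atTop_mul_const Real.pi_pos

theorem isSqZeroSeq_neg_half :
    IsSqZeroSeq (struveEntire (-1 / 2)) fun n => ((n : ℝ) + 1) * Real.pi where
  pos n := by positivity
  strictMono := fun a b h => by
    have : (a : ℝ) < b := by exact_mod_cast h
    have := Real.pi_pos
    simp only
    gcongr
  tendsto := tendsto_succ_mul_pi
  zero n := by
    have h := mul_struveEntire_neg_half (((n : ℝ) + 1) * Real.pi)
    have h2 : Complex.sin (((n : ℝ) + 1) * Real.pi) = 0 := by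
      have := sin_int_mul_pi_complex (n + 1)
      push_cast at this ⊢
      exact this
    rw [h2, mul_eq_zero, or_iff_right] at h
    · push_cast at h ⊢
      exact h
    · have : ((n : ℝ) + 1) * Real.pi ≠ 0 := by positivity
      exact_mod_cast this
  exists_eq t ht h := by
    by_contra! hne
    refine struveEntire_neg_half_ne_zero ?_ h
    rintro ⟨n, hn⟩
    have h2 : sinZeroSq n = t ^ 2 := Complex.ofReal_injective hn
    refine hne n ((pow_left_inj₀ ht.le (by positivity) two_ne_zero).1 ?_)
    rw [← h2, sinZeroSq]

/-- Differentiating z q(z²) = sin z at (n+1)π would otherwise give cos((n+1)π) = 0. -/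
theorem deriv_struveEntire_neg_half_ne_zero (n : ℕ) :
    deriv (struveEntire (-1 / 2)) ((((n + 1) * Real.pi) ^ 2 : ℝ) : ℂ) ≠ 0 := by
  intro h
  have hd : HasDerivAt (fun z : ℂ => z * struveEntire (-1 / 2) (z ^ 2))
      (1 * struveEntire (-1 / 2) ((((n + 1) * Real.pi : ℝ) : ℂ) ^ 2) +
        (((n + 1) * Real.pi : ℝ) : ℂ) * (deriv (struveEntire (-1 / 2))
          ((((n + 1) * Real.pi : ℝ) : ℂ) ^ 2) * (2 * (((n + 1) * Real.pi : ℝ) : ℂ))))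
      (((n + 1) * Real.pi : ℝ) : ℂ) := by
    have h1 := ((differentiable_struveEntire (-1 / 2)).differentiableAt
      (x := ((((n + 1) * Real.pi : ℝ) : ℂ) ^ 2))).hasDerivAt
    have h2 := (hasDerivAt_pow 2 (((n + 1) * Real.pi : ℝ) : ℂ))
    have h3 := HasDerivAt.comp (h := fun z : ℂ => z ^ 2) (((n + 1) * Real.pi : ℝ) : ℂ) h1 h2
    convert! (hasDerivAt_id (((n + 1) * Real.pi : ℝ) : ℂ)).mul h3 using 1
    simp
  rw [show (fun z : ℂ => z * struveEntire (-1 / 2) (z ^ 2)) = Complex.sin from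
    funext mul_struveEntire_neg_half] at hd
  have h3 := hd.unique (Complex.hasDerivAt_sin _)
  have h4 := isSqZeroSeq_neg_half.zero n
  rw [Complex.ofReal_pow] at h h4
  rw [h, h4, show ((((n : ℝ) + 1) * Real.pi : ℝ) : ℂ) = ((n + 1 : ℤ) : ℂ) * Real.pi by
    push_cast; rfl, cos_int_mul_pi_complex] at h3
  simp at h3
  exact zpow_ne_zero _ (by norm_num) h3.symm

theorem isSqZeroSeq_half :
    IsSqZeroSeq (struveEntire (1 / 2)) fun n => 2 * (((n : ℝ) + 1) * Real.pi) where
  pos n := by positivity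
  strictMono := fun a b h => by
    have := isSqZeroSeq_neg_half.strictMono h
    simp only at this ⊢
    linarith
  tendsto := tendsto_succ_mul_pi.const_mul_atTop two_pos
  zero n := by
    rw [struveEntire_half]
    have h := isSqZeroSeq_neg_half.zero n
    have e : (((2 * (((n : ℝ) + 1) * Real.pi)) ^ 2 : ℝ) : ℂ) / 4 =
        (((((n : ℝ) + 1) * Real.pi) ^ 2 : ℝ) : ℂ) := by
      push_cast; ring
    rw [e, h, zero_pow two_ne_zero]
  exists_eq t ht h := by
    rw [struveEntire_half, sq_eq_zero_iff] at h
    have e : ((t ^ 2 : ℝ) : ℂ) / 4 = (((t / 2) ^ 2 : ℝ) : ℂ) := by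
      push_cast; ring
    rw [e] at h
    obtain ⟨n, hn⟩ := isSqZeroSeq_neg_half.exists_eq (t / 2) (by positivity) h
    exact ⟨n, by linarith⟩

theorem hasDerivAt_struveEntire_half (w : ℂ) : HasDerivAt (struveEntire (1 / 2))
    (struveEntire (-1 / 2) (w / 4) * deriv (struveEntire (-1 / 2)) (w / 4) / 2) w := by
  have h1 := ((differentiable_struveEntire (-1 / 2)).differentiableAt (x := w / 4)).hasDerivAt
  have h2 := (h1.comp w ((hasDerivAt_id w).div_const 4)).pow 2
  rw [show struveEntire (1 / 2) = fun w => struveEntire (-1 / 2) (w / 4) ^ 2 from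
    funext struveEntire_half]
  convert! h2 using 1
  simp
  ring

/-- At these zeros the second derivative of q_{-1/2}(w/4)² is q_{-1/2}'(w/4)²/8, so the zeros have
order exactly two. -/
theorem deriv_deriv_struveEntire_half_ne_zero (n : ℕ) :
    deriv (deriv (struveEntire (1 / 2))) (((2 * (((n : ℝ) + 1) * Real.pi)) ^ 2 : ℝ) : ℂ) ≠ 0 := by
  have hd : deriv (struveEntire (1 / 2)) = fun w =>
      struveEntire (-1 / 2) (w / 4) * deriv (struveEntire (-1 / 2)) (w / 4) / 2 :=
    funext fun w => (hasDerivAt_struveEntire_half w).deriv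
  rw [hd]
  set w := (((2 * (((n : ℝ) + 1) * Real.pi)) ^ 2 : ℝ) : ℂ) with hw
  have e : w / 4 = (((((n : ℝ) + 1) * Real.pi) ^ 2 : ℝ) : ℂ) := by
    rw [hw]; push_cast; ring
  have hq := differentiable_struveEntire (-1 / 2)
  have hq' : Differentiable ℂ (deriv (struveEntire (-1 / 2))) := hq.deriv
  have h4 := (hasDerivAt_id w).div_const 4
  have h1 := (hq.differentiableAt (x := w / 4)).hasDerivAt.comp w h4
  have h2 := (hq'.differentiableAt (x := w / 4)).hasDerivAt.comp w h4
  have h3 := (h1.mul h2).div_const 2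
  have h5 := h3.deriv
  simp only [Function.comp_def, id_eq, Pi.mul_def] at h5
  rw [h5, e, isSqZeroSeq_neg_half.zero n, zero_mul, add_zero]
  have := deriv_struveEntire_neg_half_ne_zero n
  simpa using this

theorem sinZeroSq_strictMono : StrictMono sinZeroSq := by
  intro a b h
  have h2 : (a : ℝ) < b := by exact_mod_cast h
  have := Real.pi_pos
  unfold sinZeroSq
  gcongr

theorem exists_between_sinZeroSq {x : ℝ} (hV : (x : ℂ) ∈ sinPoleCompl) :
    x < sinZeroSq 0 ∨ ∃ n, x ∈ Set.Ioo (sinZeroSq n) (sinZeroSq (n + 1)) := by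
  have hne : ∀ n, sinZeroSq n ≠ x := fun n h => hV ⟨n, by rw [← h]⟩
  have hex : ∃ n, x < sinZeroSq n := (tendsto_sinZeroSq.eventually_gt_atTop x).exists
  classical
  set m := Nat.find hex with hm
  rcases h : m with _ | k
  · left
    rw [← h]
    exact Nat.find_spec hex
  · right
    refine ⟨k, lt_of_le_of_ne (not_lt.1 (Nat.find_min hex (m := k) (by lia))) (hne k), ?_⟩
    rw [← h]
    exact Nat.find_spec hex

/-- Every term of the expansion increases between consecutive poles. Keeping only the term k = 0
leaves an explicit lower bound for the growth, enough for both uniqueness and simplicity of zeros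
without differentiating the series. -/
theorem struveRatio_sub_ge {ν : ℝ} (h0 : -1 / 2 < ν) (h1 : ν < 1 / 2) {n : ℕ} {x y : ℝ}
    (hx : x ∈ Set.Ioo (sinZeroSq n) (sinZeroSq (n + 1)))
    (hy : y ∈ Set.Ioo (sinZeroSq n) (sinZeroSq (n + 1))) (hxy : x ≤ y) :
    struveResidue ν 0 * sinZeroSq 0 / ((sinZeroSq 0 - x) * (sinZeroSq 0 - y)) * (y - x) ≤
      (struveEntire ν y).re / (struveEntire (-1 / 2) y).re -
        (struveEntire ν x).re / (struveEntire (-1 / 2) x).re := by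
  have hV : ∀ u ∈ Set.Ioo (sinZeroSq n) (sinZeroSq (n + 1)), (u : ℂ) ∈ sinPoleCompl := by
    rintro u hu ⟨k, hk⟩
    have hk' : sinZeroSq k = u := Complex.ofReal_injective hk
    rw [← hk'] at hu
    have h2 := sinZeroSq_strictMono.lt_iff_lt.1 hu.1
    have h3 := sinZeroSq_strictMono.lt_iff_lt.1 hu.2
    lia
  have hs := (hasSum_struveResidue_real h0 h1.le (hV y hy)).sub
    (hasSum_struveResidue_real h0 h1.le (hV x hx))
  have hsign : ∀ k, 0 < (sinZeroSq k - x) * (sinZeroSq k - y) := by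
    intro k
    rcases le_or_gt k n with hk | hk
    · have := sinZeroSq_strictMono.monotone hk
      exact mul_pos_of_neg_of_neg (by linarith [hx.1]) (by linarith [hy.1])
    · have := sinZeroSq_strictMono.monotone (Nat.succ_le_of_lt hk)
      exact mul_pos (by linarith [hx.2]) (by linarith [hy.2])
  have hterm : ∀ k, struveResidue ν k * (y / (sinZeroSq k - y)) -
      struveResidue ν k * (x / (sinZeroSq k - x)) =
      struveResidue ν k * sinZeroSq k / ((sinZeroSq k - x) * (sinZeroSq k - y)) * (y - x) := by
    intro k
    have h2 := (hsign k).ne'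
    have h3 := left_ne_zero_of_mul h2
    have h4 := right_ne_zero_of_mul h2
    field_simp
    ring
  simp_rw [hterm] at hs
  have := le_hasSum hs 0 fun k _ => by
    have h2 := hsign k
    have h3 := struveResidue_pos h0 h1 k
    have h4 := sinZeroSq_pos k
    have h5 := sub_nonneg.2 hxy
    positivity
  linarith

/-- Below the first pole all terms of the expansion are nonnegative, so q_ν/q_{-1/2} ≥ 1. -/
theorem struveEntire_ne_zero_of_lt {ν : ℝ} (h0 : -1 / 2 < ν) (h1 : ν < 1 / 2) {x : ℝ}
    (hx : 0 < x) (hx1 : x < sinZeroSq 0) : struveEntire ν x ≠ 0 := by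
  have hlt : ∀ k, x < sinZeroSq k := fun k =>
    hx1.trans_le (sinZeroSq_strictMono.monotone (Nat.zero_le k))
  have hV : (x : ℂ) ∈ sinPoleCompl := by
    rintro ⟨k, hk⟩
    exact (hlt k).ne' (Complex.ofReal_injective hk)
  have hs := (hasSum_struveResidue_real h0 h1.le hV).nonneg fun k => by
    have := struveResidue_pos h0 h1 k
    have := sub_pos.2 (hlt k)
    positivity
  intro h
  rw [h] at hs
  norm_num at hs

theorem struveEntire_sinZeroSq_sign {ν : ℝ} (h0 : -1 / 2 < ν) (h1 : ν < 1 / 2) (n : ℕ) :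
    0 < (-1) ^ n * (struveEntire ν (sinZeroSq n)).re := by
  have h := struveSine_eq h0 h1.le ((n + 1) * Real.pi)
  rw [struveSine_sinZero] at h
  have e : (((n : ℂ) + 1) * Real.pi) ^ 2 = (sinZeroSq n : ℂ) := by
    rw [sinZeroSq]; push_cast; rfl
  rw [e, struveEntire_ofReal h0.le] at h
  have h2 : (-1) ^ n * (∫ t in (0 : ℝ)..1, struveWeight ν t *
      Real.sin ((n + 1) * Real.pi * (1 - t))) = struveMoment ν 0 * (((n + 1) * Real.pi) *
        (struveEntire ν (sinZeroSq n)).re) := by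
    exact_mod_cast h
  have hJ := struveWeight_integral_sin_pos h0 h1 n
  have hM := struveMoment_zero_pos h0 h1.le
  have h3 : ((-1 : ℝ) ^ n) * (-1) ^ n = 1 := by rw [← mul_pow]; simp
  have h4 : (∫ t in (0 : ℝ)..1, struveWeight ν t *
      Real.sin ((n + 1) * Real.pi * (1 - t))) = (struveMoment ν 0 * ((n + 1) * Real.pi)) *
        ((-1) ^ n * (struveEntire ν (sinZeroSq n)).re) := by
    linear_combination (-1) ^ n * h2 - (∫ t in (0 : ℝ)..1, struveWeight ν t *
      Real.sin ((n + 1) * Real.pi * (1 - t))) * h3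
  rw [h4] at hJ
  exact pos_of_mul_pos_right hJ (by positivity)

theorem exists_zero_between {ν : ℝ} (h0 : -1 / 2 < ν) (h1 : ν < 1 / 2) (n : ℕ) :
    ∃ x ∈ Set.Ioo (sinZeroSq n) (sinZeroSq (n + 1)), struveEntire ν x = 0 := by
  have hc : Continuous fun x : ℝ => (-1) ^ n * (struveEntire ν x).re := by
    have := (differentiable_struveEntire ν).continuous
    exact continuous_const.mul (Complex.continuous_re.comp (this.comp Complex.continuous_ofReal))
  have hn := struveEntire_sinZeroSq_sign h0 h1 n
  have hn1 := struveEntire_sinZeroSq_sign h0 h1 (n + 1)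
  rw [pow_succ] at hn1
  obtain ⟨x, hx, hx0⟩ := intermediate_value_Ioo' (sinZeroSq_strictMono n.lt_succ_self).le
    hc.continuousOn (show (0 : ℝ) ∈ Set.Ioo _ _ from ⟨by simp only [Nat.succ_eq_add_one]; linarith, hn⟩)
  refine ⟨x, hx, ?_⟩
  rw [struveEntire_ofReal h0.le]
  simpa using hx0

theorem struveEntire_neg_half_re_ne_zero {x : ℝ} (h : (x : ℂ) ∈ sinPoleCompl) :
    (struveEntire (-1 / 2) x).re ≠ 0 := by
  intro h2
  refine struveEntire_neg_half_ne_zero h ?_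
  rw [struveEntire_ofReal le_rfl, h2, Complex.ofReal_zero]

theorem mem_sinPoleCompl_of_mem_Ioo {n : ℕ} {x : ℝ}
    (hx : x ∈ Set.Ioo (sinZeroSq n) (sinZeroSq (n + 1))) : (x : ℂ) ∈ sinPoleCompl := by
  rintro ⟨k, hk⟩
  have hk' : sinZeroSq k = x := Complex.ofReal_injective hk
  rw [← hk'] at hx
  have h2 := sinZeroSq_strictMono.lt_iff_lt.1 hx.1
  have h3 := sinZeroSq_strictMono.lt_iff_lt.1 hx.2
  lia

theorem struveEntire_zero_unique {ν : ℝ} (h0 : -1 / 2 < ν) (h1 : ν < 1 / 2) {n : ℕ} {x y : ℝ}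
    (hx : x ∈ Set.Ioo (sinZeroSq n) (sinZeroSq (n + 1)))
    (hy : y ∈ Set.Ioo (sinZeroSq n) (sinZeroSq (n + 1))) (hx0 : struveEntire ν x = 0)
    (hy0 : struveEntire ν y = 0) : x = y := by
  wlog hxy : x ≤ y generalizing x y
  · exact (this hy hx hy0 hx0 (le_of_not_ge hxy)).symm
  have h := struveRatio_sub_ge h0 h1 hx hy hxy
  rw [hx0, hy0] at h
  simp only [Complex.zero_re, zero_div, sub_zero] at h
  have h2 : sinZeroSq 0 ≤ sinZeroSq n := sinZeroSq_strictMono.monotone (Nat.zero_le n)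
  have h3 : 0 < (sinZeroSq 0 - x) * (sinZeroSq 0 - y) :=
    mul_pos_of_neg_of_neg (by linarith [hx.1]) (by linarith [hy.1])
  have h4 := struveResidue_pos h0 h1 0
  have h5 := sinZeroSq_pos 0
  by_contra hne
  have h6 : 0 < y - x := sub_pos.2 (lt_of_le_of_ne hxy hne)
  exact absurd h (not_le.2 (by positivity))

theorem re_hasDerivAt {q : ℂ → ℂ} (hq : Differentiable ℂ q) (x : ℝ) :
    HasDerivAt (fun x : ℝ => (q x).re) (deriv q x).re x :=
  (hq.differentiableAt (x := (x : ℂ))).hasDerivAt.real_of_complex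

/-- At a multiple zero q_ν/q_{-1/2} would have slope 0, whereas `struveRatio_sub_ge` bounds the
slope below by r_0 λ_0/(λ_0 - x)² > 0. -/
theorem deriv_struveEntire_ne_zero {ν : ℝ} (h0 : -1 / 2 < ν) (h1 : ν < 1 / 2) {n : ℕ} {x : ℝ}
    (hx : x ∈ Set.Ioo (sinZeroSq n) (sinZeroSq (n + 1))) (hx0 : struveEntire ν x = 0) :
    deriv (struveEntire ν) x ≠ 0 := by
  intro hd
  have hS := struveEntire_neg_half_re_ne_zero (mem_sinPoleCompl_of_mem_Ioo hx)
  have hdiv := (re_hasDerivAt (differentiable_struveEntire ν) x).div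
    (re_hasDerivAt (differentiable_struveEntire (-1 / 2)) x) hS
  rw [hd, hx0] at hdiv
  simp only [Complex.zero_re, zero_mul, sub_zero, zero_div] at hdiv
  have hslope := hdiv.tendsto_slope.mono_left (nhdsWithin_mono x fun y (hy : x < y) => hy.ne')
  have h2 : sinZeroSq 0 ≤ sinZeroSq n := sinZeroSq_strictMono.monotone (Nat.zero_le n)
  have hne : (sinZeroSq 0 - x) * (sinZeroSq 0 - x) ≠ 0 := by
    have : sinZeroSq 0 - x ≠ 0 := by linarith [hx.1]
    positivity
  have hlow : Tendsto (fun y => struveResidue ν 0 * sinZeroSq 0 /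
      ((sinZeroSq 0 - x) * (sinZeroSq 0 - y))) (𝓝[>] x)
      (𝓝 (struveResidue ν 0 * sinZeroSq 0 / ((sinZeroSq 0 - x) * (sinZeroSq 0 - x)))) := by
    refine tendsto_nhdsWithin_of_tendsto_nhds ?_
    exact tendsto_const_nhds.div (Continuous.tendsto (by fun_prop) x) hne
  have hle := le_of_tendsto_of_tendsto hlow hslope (by
    filter_upwards [Ioo_mem_nhdsGT hx.2] with y hy
    have h := struveRatio_sub_ge h0 h1 hx ⟨hx.1.trans hy.1, hy.2⟩ hy.1.le
    rw [slope_def_field, le_div_iff₀ (sub_pos.2 hy.1)]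
    exact h)
  have h3 : 0 < (sinZeroSq 0 - x) * (sinZeroSq 0 - x) :=
    mul_pos_of_neg_of_neg (by linarith [hx.1]) (by linarith [hx.1])
  have h4 := struveResidue_pos h0 h1 0
  have h5 := sinZeroSq_pos 0
  exact absurd hle (not_le.2 (by positivity))

theorem exists_isSqZeroSeq_of_lt {ν : ℝ} (h0 : -1 / 2 < ν) (h1 : ν < 1 / 2) :
    ∃ x, IsSqZeroSeq (struveEntire ν) x ∧ ∀ n, deriv (struveEntire ν) ((x n ^ 2 : ℝ) : ℂ) ≠ 0 := by
  choose u hu hu0 using exists_zero_between h0 h1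
  have hupos : ∀ n, 0 < u n := fun n => (sinZeroSq_pos n).trans (hu n).1
  have hsq : ∀ n, √(u n) ^ 2 = u n := fun n => Real.sq_sqrt (hupos n).le
  refine ⟨fun n => √(u n), ⟨fun n => Real.sqrt_pos.2 (hupos n), ?_, ?_, ?_, ?_⟩, ?_⟩
  · exact strictMono_nat_of_lt_succ fun n =>
      Real.sqrt_lt_sqrt (hupos n).le ((hu n).2.trans (hu (n + 1)).1)
  · exact Real.tendsto_sqrt_atTop.comp
      (tendsto_atTop_mono (fun n => (hu n).1.le) tendsto_sinZeroSq)
  · intro n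
    simp only [hsq]
    exact hu0 n
  · intro t ht h
    have hV : ((t ^ 2 : ℝ) : ℂ) ∈ sinPoleCompl := by
      rintro ⟨k, hk⟩
      have hk' : sinZeroSq k = t ^ 2 := Complex.ofReal_injective hk
      have := struveEntire_sinZeroSq_sign h0 h1 k
      rw [hk', h] at this
      simp at this
    rcases exists_between_sinZeroSq hV with hlt | ⟨n, hn⟩
    · exact absurd h (struveEntire_ne_zero_of_lt h0 h1 (pow_pos ht 2) hlt)
    · refine ⟨n, ?_⟩
      rw [← struveEntire_zero_unique h0 h1 hn (hu n) h (hu0 n), Real.sqrt_sq ht.le]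
  · intro n
    simp only [hsq]
    exact deriv_struveEntire_ne_zero h0 h1 (hu n) (hu0 n)

theorem exists_isSqZeroSeq {ν : ℝ} (h0 : -1 / 2 ≤ ν) (h1 : ν < 1 / 2) :
    ∃ x, IsSqZeroSeq (struveEntire ν) x ∧ ∀ n, deriv (struveEntire ν) ((x n ^ 2 : ℝ) : ℂ) ≠ 0 := by
  rcases h0.eq_or_lt with rfl | h0
  · exact ⟨_, isSqZeroSeq_neg_half, deriv_struveEntire_neg_half_ne_zero⟩
  · exact exists_isSqZeroSeq_of_lt h0 h1

/-! ### Critical points: reality, simplicity, interlacing -/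

theorem PosRootLimit.conj_eq {q : ℂ → ℂ} (h : PosRootLimit q) {w : ℂ} (hw : w.im ≠ 0) :
    q ((starRingEnd ℂ) w) = (starRingEnd ℂ) (q w) ∧
      deriv q ((starRingEnd ℂ) w) = (starRingEnd ℂ) (deriv q w) := by
  obtain ⟨s, hs, hl⟩ := h
  have h1 := tendsto_derivs hl (mem_sinPoleCompl_of_im_ne_zero hw)
  have h2 := tendsto_derivs hl (w := (starRingEnd ℂ) w)
    (mem_sinPoleCompl_of_im_ne_zero (by simpa using hw))
  simp only [Polynomial.aeval_conj] at h2
  exact ⟨tendsto_nhds_unique h2.1 ((Complex.continuous_conj.tendsto _).comp h1.1),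
    tendsto_nhds_unique h2.2.1 ((Complex.continuous_conj.tendsto _).comp h1.2.1)⟩

/-- The function `d` with `(z ^ a q(z ^ 2))' = z ^ (a - 1) d(z ^ 2)`. -/
def sqLogDeriv (a : ℝ) (q : ℂ → ℂ) (w : ℂ) : ℂ := a * q w + 2 * w * deriv q w

section

variable {q : ℂ → ℂ} {a : ℝ}

theorem hasDerivAt_sqLogDeriv (hq : Differentiable ℂ q) (w : ℂ) :
    HasDerivAt (sqLogDeriv a q) ((a + 2) * deriv q w + 2 * w * deriv (deriv q) w) w := by
  have h1 := (hq.differentiableAt (x := w)).hasDerivAt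
  have h2 := (hq.deriv.differentiableAt (x := w)).hasDerivAt
  have h3 := (h1.const_mul (a : ℂ)).add (((hasDerivAt_id w).const_mul 2).mul h2)
  convert! h3 using 1
  simp
  ring

/-- At a zero, w q' = -(a/2) q, so w q' times the conjugate of q is real. Then `im_bound` forces q'
= 0, hence q = 0, but the zeros of q are real. -/
theorem sqLogDeriv_ne_zero_of_im_pos (hL : PosRootLimit q) (hq : Differentiable ℂ q) (ha : 0 < a)
    {w : ℂ} (hw : 0 < w.im) : sqLogDeriv a q w ≠ 0 := by
  intro h
  have ha' : (a : ℂ) ≠ 0 := by exact_mod_cast ha.ne'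
  have h1 : w * deriv q w = ((-(a / 2) : ℝ) : ℂ) * q w := by
    unfold sqLogDeriv at h
    push_cast
    linear_combination h / 2
  have h2 := hL.im_bound hw
  rw [h1, mul_assoc, Complex.mul_conj, ← Complex.ofReal_mul, Complex.ofReal_im, neg_zero,
    mul_zero] at h2
  have h3 : Complex.normSq (deriv q w) = 0 :=
    le_antisymm (nonpos_of_mul_nonpos_left h2 hw) (Complex.normSq_nonneg _)
  rw [Complex.normSq_eq_zero] at h3
  rw [sqLogDeriv, h3, mul_zero, add_zero, mul_eq_zero, or_iff_right ha'] at h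
  exact hw.ne' (hL.zeros_pos hq h).1

theorem sqLogDeriv_zeros (hL : PosRootLimit q) (hq : Differentiable ℂ q) (ha : 0 < a)
    {w : ℂ} (h : sqLogDeriv a q w = 0) : w.im = 0 ∧ 0 < w.re := by
  have him : w.im = 0 := by
    rcases lt_trichotomy w.im 0 with hlt | heq | hgt
    · refine absurd ?_ (sqLogDeriv_ne_zero_of_im_pos hL hq ha (w := (starRingEnd ℂ) w)
        (by simpa using hlt))
      have h2 := congrArg (starRingEnd ℂ) h
      obtain ⟨e1, e2⟩ := hL.conj_eq hlt.ne
      rw [sqLogDeriv, e1, e2]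
      simpa [sqLogDeriv, map_ofNat] using h2
    · exact heq
    · exact absurd h (sqLogDeriv_ne_zero_of_im_pos hL hq ha hgt)
  refine ⟨him, ?_⟩
  by_contra! hre
  have hwx : w = (w.re : ℂ) := by apply Complex.ext <;> simp [him]
  rw [hwx] at h
  generalize w.re = x at hre h
  obtain ⟨h1, h2⟩ := hL.re_nonpos hre
  have h3 := congrArg Complex.re h
  simp [sqLogDeriv] at h3
  have : 0 ≤ x * (deriv q x).re := mul_nonneg_of_nonpos_of_nonpos hre h2
  nlinarith

theorem deriv_eq_re_of_real (hreal : ∀ x : ℝ, q x = (q x).re) (hq : Differentiable ℂ q) (x : ℝ) :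
    deriv q x = (deriv q x).re := by
  have h1 := (hq.differentiableAt (x := (x : ℂ))).hasDerivAt.comp_ofReal
  have h2 := (re_hasDerivAt hq x).ofReal_comp
  have e : (fun y : ℝ => (((q y).re : ℝ) : ℂ)) = fun y : ℝ => q y := funext fun y => (hreal y).symm
  rw [e] at h2
  exact h1.unique h2

theorem sqLogDeriv_re (x : ℝ) :
    (sqLogDeriv a q x).re = a * (q x).re + 2 * (x * (deriv q x).re) := by
  simp [sqLogDeriv, mul_assoc]

theorem sqLogDeriv_eq_re_of_real (hreal : ∀ x : ℝ, q x = (q x).re) (hq : Differentiable ℂ q)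
    (x : ℝ) : sqLogDeriv a q x = (sqLogDeriv a q x).re := by
  rw [sqLogDeriv_re, sqLogDeriv, deriv_eq_re_of_real hreal hq, hreal]
  push_cast
  simp [mul_assoc]

/-- The Laguerre expression equals (q' d - q d')/2. If d = d' = 0 it vanishes, which forces q' = 0,
then q = 0 and q'' = 0: a zero of q of order at least three, excluded by `h2`. -/
theorem deriv_sqLogDeriv_ne_zero (hL : PosRootLimit q) (hreal : ∀ x : ℝ, q x = (q x).re)
    (hq : Differentiable ℂ q) (ha : 0 < a)
    (h2 : ∀ x : ℝ, 0 < x → q x = 0 → deriv q x = 0 → deriv (deriv q) x ≠ 0) {w : ℂ}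
    (hw : sqLogDeriv a q w = 0) : deriv (sqLogDeriv a q) w ≠ 0 := by
  intro hd
  obtain ⟨him, hre⟩ := sqLogDeriv_zeros hL hq ha hw
  have hwx : w = (w.re : ℂ) := by apply Complex.ext <;> simp [him]
  rw [hwx] at hw hd
  generalize w.re = x at hre hw hd
  rw [(hasDerivAt_sqLogDeriv hq _).deriv] at hd
  have e1 := congrArg Complex.re hw
  rw [sqLogDeriv_re, Complex.zero_re] at e1
  have e2 := congrArg Complex.re hd
  have hl := hL.laguerre hq x
  have hq1 := deriv_eq_re_of_real hreal hq x
  have hq2 := deriv_eq_re_of_real (deriv_eq_re_of_real hreal hq) hq.deriv x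
  have hq0 := hreal x
  have e3 : (a + 2) * (deriv q x).re + 2 * (x * (deriv (deriv q) x).re) = 0 := by
    rw [hq1, hq2] at e2
    have e4 : ((a : ℂ) + 2) * ((deriv q x).re : ℂ) + 2 * x * ((deriv (deriv q) x).re : ℂ) =
        (((a + 2) * (deriv q x).re + 2 * (x * (deriv (deriv q) x).re) : ℝ) : ℂ) := by
      push_cast; ring
    rw [e4, Complex.ofReal_re, Complex.zero_re] at e2
    exact e2
  have e5 : x * (deriv q x).re ^ 2 - x * (q x).re * (deriv (deriv q) x).re
        - (q x).re * (deriv q x).re = 0 := by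
    linear_combination (1 / 2) * (deriv q x).re * e1 - (1 / 2) * (q x).re * e3
  rw [e5, mul_zero] at hl
  have e6 : (deriv q x).re = 0 := by
    have := sq_nonneg (deriv q x).re
    exact pow_eq_zero_iff two_ne_zero |>.1 (le_antisymm hl this)
  rw [e6, mul_zero, mul_zero, add_zero, mul_eq_zero, or_iff_right ha.ne'] at e1
  refine h2 x hre (by rw [hq0, e1, Complex.ofReal_zero]) (by rw [hq1, e6, Complex.ofReal_zero]) ?_
  rw [e6, mul_zero, zero_add, mul_eq_zero, or_iff_right two_ne_zero, mul_eq_zero,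
    or_iff_right hre.ne'] at e3
  rw [hq2, e3, Complex.ofReal_zero]

/-- The quotient t q'/q is nonincreasing where q ≠ 0 and equals -a/2 at both ends, so it is
constant. Equality in Laguerre then gives q' = 0 inside, and the constant would be 0. -/
theorem sqLogDeriv_zero_unique (hL : PosRootLimit q) (hreal : ∀ x : ℝ, q x = (q x).re)
    (hq : Differentiable ℂ q) (ha : 0 < a) {x y : ℝ}
    (hxy : x < y) (hne : ∀ t ∈ Set.Icc x y, q t ≠ 0) (hx0 : sqLogDeriv a q x = 0)
    (hy0 : sqLogDeriv a q y = 0) : False := by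
  have hne' : ∀ t ∈ Set.Icc x y, (q t).re ≠ 0 := fun t ht h =>
    hne t ht (by rw [hreal, h, Complex.ofReal_zero])
  set S := (-(deriv q 0)).re with hS
  have hlag := hL.laguerre hq
  -- If S = 0, Laguerre gives q'(x) = 0, and d(x) = 0 then gives q(x) = 0.
  have hSpos : 0 < S := by
    by_contra! hle
    have h1 : 0 ≤ S := by
      have := (hL.re_nonpos le_rfl).2
      rw [Complex.ofReal_zero] at this
      rw [hS, Complex.neg_re]
      linarith
    have h2 := hlag x
    rw [← hS, le_antisymm hle h1, zero_mul] at h2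
    have h3 : (deriv q x).re = 0 :=
      pow_eq_zero_iff two_ne_zero |>.1 (le_antisymm h2 (sq_nonneg _))
    have e1 := congrArg Complex.re hx0
    rw [sqLogDeriv_re, h3, mul_zero, mul_zero, add_zero, Complex.zero_re, mul_eq_zero,
      or_iff_right ha.ne'] at e1
    exact hne' x ⟨le_rfl, hxy.le⟩ e1
  have hder : ∀ t, (q (t : ℝ)).re ≠ 0 → HasDerivAt (fun t : ℝ => t * (deriv q t).re / (q t).re)
      (((1 * (deriv q t).re + t * (deriv (deriv q) t).re) * (q t).re -
        t * (deriv q t).re * (deriv q t).re) / (q t).re ^ 2) t := fun t ht =>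
    ((hasDerivAt_id t).mul (re_hasDerivAt hq.deriv t)).div (re_hasDerivAt hq t) ht
  have hval : ∀ t, (q (t : ℝ)).re ≠ 0 → sqLogDeriv a q t = 0 →
      t * (deriv q t).re / (q t).re = -(a / 2) := by
    intro t ht h
    have e1 := congrArg Complex.re h
    rw [sqLogDeriv_re, Complex.zero_re] at e1
    field_simp
    linarith
  have hnn : ∀ t : ℝ, 0 ≤ t * (deriv q t).re ^ 2 - t * (q t).re * (deriv (deriv q) t).re
      - (q t).re * (deriv q t).re := fun t =>
    (mul_nonneg_iff_of_pos_left hSpos).1 ((sq_nonneg _).trans (hlag t))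
  have hanti : AntitoneOn (fun t : ℝ => t * (deriv q t).re / (q t).re) (Set.Icc x y) := by
    refine antitoneOn_of_deriv_nonpos (convex_Icc x y)
      (fun t ht => (hder t (hne' t ht)).continuousAt.continuousWithinAt)
      (fun t ht => (hder t (hne' t (interior_subset ht))).differentiableAt.differentiableWithinAt)
      fun t ht => ?_
    rw [(hder t (hne' t (interior_subset ht))).deriv]
    refine div_nonpos_of_nonpos_of_nonneg ?_ (sq_nonneg _)
    linarith [hnn t]
  have hconst : ∀ t ∈ Set.Icc x y, t * (deriv q t).re / (q t).re = -(a / 2) := by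
    intro t ht
    have hx := Set.left_mem_Icc.2 hxy.le
    have hy := Set.right_mem_Icc.2 hxy.le
    refine le_antisymm ?_ ?_
    · rw [← hval x (hne' x hx) hx0]
      exact hanti hx ht ht.1
    · rw [← hval y (hne' y hy) hy0]
      exact hanti ht hy ht.2
  obtain ⟨m, hm⟩ := Set.nonempty_Ioo.2 hxy
  have hmI := Set.Ioo_subset_Icc_self hm
  have hm0 := hne' m hmI
  have hd0 := (hder m hm0).unique ((hasDerivAt_const m (-(a / 2))).congr_of_eventuallyEq (by
    filter_upwards [Ioo_mem_nhds hm.1 hm.2] with t ht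
    exact hconst t (Set.Ioo_subset_Icc_self ht)))
  rw [div_eq_zero_iff, or_iff_left (pow_ne_zero 2 hm0)] at hd0
  have h4 := hlag m
  rw [show m * (deriv q m).re ^ 2 - m * (q m).re * (deriv (deriv q) m).re
      - (q m).re * (deriv q m).re = 0 by linarith, mul_zero] at h4
  have h5 : (deriv q m).re = 0 :=
    pow_eq_zero_iff two_ne_zero |>.1 (le_antisymm h4 (sq_nonneg _))
  have h6 := hconst m hmI
  rw [h5, mul_zero, zero_div] at h6
  linarith

/-- The predecessor of `x n` in the sequence `0, x 0, x 1, …`. -/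
def prevZero (x : ℕ → ℝ) (n : ℕ) : ℝ := if n = 0 then 0 else x (n - 1)

theorem prevZero_succ (x : ℕ → ℝ) (n : ℕ) : prevZero x (n + 1) = x n := by simp [prevZero]

theorem IsSqZeroSeq.prevZero_nonneg {x : ℕ → ℝ} (h : IsSqZeroSeq q x) (n : ℕ) :
    0 ≤ prevZero x n := by
  rcases n with _ | n
  · simp [prevZero]
  · rw [prevZero_succ]; exact (h.pos n).le

theorem IsSqZeroSeq.prevZero_lt {x : ℕ → ℝ} (h : IsSqZeroSeq q x) (n : ℕ) :
    prevZero x n < x n := by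
  rcases n with _ | n
  · simpa [prevZero] using h.pos 0
  · rw [prevZero_succ]; exact h.strictMono n.lt_succ_self

theorem IsSqZeroSeq.exists_mem_Ioo {x : ℕ → ℝ} (h : IsSqZeroSeq q x) {t : ℝ} (ht : 0 < t)
    (hq : q ((t ^ 2 : ℝ) : ℂ) ≠ 0) : ∃ n, t ∈ Set.Ioo (prevZero x n) (x n) := by
  have hne : ∀ n, x n ≠ t := fun n he => hq (by rw [← he]; exact h.zero n)
  have hex : ∃ n, t < x n := (h.tendsto.eventually_gt_atTop t).exists
  classical
  refine ⟨Nat.find hex, ?_, Nat.find_spec hex⟩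
  rcases hm : Nat.find hex with _ | k
  · simpa [prevZero] using ht
  · rw [prevZero_succ]
    exact lt_of_le_of_ne (not_lt.1 (Nat.find_min hex (m := k) (by lia))) (hne k)

theorem IsSqZeroSeq.ne_zero_of_mem_Ioo {x : ℕ → ℝ} (h : IsSqZeroSeq q x) {n : ℕ} {t : ℝ}
    (ht : t ∈ Set.Ioo (prevZero x n) (x n)) : q ((t ^ 2 : ℝ) : ℂ) ≠ 0 := by
  intro h0
  obtain ⟨k, rfl⟩ := h.exists_eq t ((h.prevZero_nonneg n).trans_lt ht.1) h0
  have h1 := h.strictMono.lt_iff_lt.1 ht.2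
  rcases n with _ | n
  · lia
  · have h2 := ht.1
    rw [prevZero_succ] at h2
    have h3 := h.strictMono.lt_iff_lt.1 h2
    lia

theorem hasDerivAt_rpow_mul_comp_sq (hq : Differentiable ℂ q) {t : ℝ} (ht : 0 < t) :
    HasDerivAt (fun t : ℝ => t ^ a * (q ((t ^ 2 : ℝ) : ℂ)).re)
      (t ^ (a - 1) * (sqLogDeriv a q ((t ^ 2 : ℝ) : ℂ)).re) t := by
  have h1 := Real.hasDerivAt_rpow_const (p := a) (Or.inl ht.ne')
  have h2 := HasDerivAt.comp (h := fun t : ℝ => t ^ 2) t (re_hasDerivAt hq (t ^ 2))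
    (hasDerivAt_pow 2 t)
  convert! h1.mul h2 using 1
  rw [sqLogDeriv_re, show t ^ a = t ^ (a - 1) * t by
    rw [← Real.rpow_add_one ht.ne', sub_add_cancel]]
  simp
  ring

/-- Rolle's theorem for t^a q(t²); since a > 0 this function also vanishes at 0, which serves the
first gap. -/
theorem IsSqZeroSeq.exists_critical {x : ℕ → ℝ} (h : IsSqZeroSeq q x)
    (hreal : ∀ x : ℝ, q x = (q x).re) (hq : Differentiable ℂ q) (ha : 0 < a) (n : ℕ) :
    ∃ y ∈ Set.Ioo (prevZero x n) (x n), sqLogDeriv a q ((y ^ 2 : ℝ) : ℂ) = 0 := by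
  have hc : Continuous fun t : ℝ => t ^ a * (q ((t ^ 2 : ℝ) : ℂ)).re := by
    refine (Real.continuous_rpow_const ha.le).mul ?_
    have := hq.continuous
    exact Complex.continuous_re.comp (this.comp (Complex.continuous_ofReal.comp (by fun_prop)))
  have hz : ∀ n, x n ^ a * (q ((x n ^ 2 : ℝ) : ℂ)).re = 0 := fun n => by
    rw [h.zero n, Complex.zero_re, mul_zero]
  have hz' : prevZero x n ^ a * (q ((prevZero x n ^ 2 : ℝ) : ℂ)).re = 0 := by
    rcases n with _ | n
    · simp [prevZero, Real.zero_rpow ha.ne']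
    · rw [prevZero_succ]; exact hz n
  obtain ⟨y, hy, hy0⟩ := exists_hasDerivAt_eq_zero (h.prevZero_lt n) hc.continuousOn
    (hz'.trans (hz n).symm) fun t ht =>
      hasDerivAt_rpow_mul_comp_sq hq ((h.prevZero_nonneg n).trans_lt ht.1)
  refine ⟨y, hy, ?_⟩
  have hypos := (h.prevZero_nonneg n).trans_lt hy.1
  rw [mul_eq_zero, or_iff_right (Real.rpow_pos_of_pos hypos _).ne'] at hy0
  rw [sqLogDeriv_eq_re_of_real hreal hq, hy0, Complex.ofReal_zero]

/-- Interlacing of the zeros of `z ^ a q(z ^ 2)` and of the critical points. -/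
theorem IsSqZeroSeq.exists_critical_seq {x : ℕ → ℝ} (h : IsSqZeroSeq q x) (hL : PosRootLimit q)
    (hreal : ∀ x : ℝ, q x = (q x).re) (hq : Differentiable ℂ q) (ha : 0 < a) :
    ∃ y : ℕ → ℝ, (∀ n, 0 < y n) ∧ (∀ n, y n < x n) ∧ (∀ n, x n < y (n + 1)) ∧
      (∀ n, sqLogDeriv a q ((y n ^ 2 : ℝ) : ℂ) = 0) ∧
      ∀ t : ℝ, 0 < t → q ((t ^ 2 : ℝ) : ℂ) ≠ 0 → sqLogDeriv a q ((t ^ 2 : ℝ) : ℂ) = 0 →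
        ∃ n, t = y n := by
  choose y hy hy0 using h.exists_critical hreal hq ha
  refine ⟨y, fun n => (h.prevZero_nonneg n).trans_lt (hy n).1, fun n => (hy n).2, fun n => ?_, hy0,
    fun t ht hqt h0 => ?_⟩
  · have := (hy (n + 1)).1
    rwa [prevZero_succ] at this
  · obtain ⟨n, hn⟩ := h.exists_mem_Ioo ht hqt
    refine ⟨n, ?_⟩
    have key : ∀ u v : ℝ, u ∈ Set.Ioo (prevZero x n) (x n) → v ∈ Set.Ioo (prevZero x n) (x n) →
        sqLogDeriv a q ((u ^ 2 : ℝ) : ℂ) = 0 → sqLogDeriv a q ((v ^ 2 : ℝ) : ℂ) = 0 →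
        ¬ u < v := by
      intro u v hu hv hu0 hv0 huv
      have hupos := (h.prevZero_nonneg n).trans_lt hu.1
      refine sqLogDeriv_zero_unique hL hreal hq ha (x := u ^ 2) (y := v ^ 2) (by gcongr) ?_ hu0 hv0
      intro s hs
      have hs0 : 0 < s := (pow_pos hupos 2).trans_le hs.1
      have e : s = √s ^ 2 := (Real.sq_sqrt hs0.le).symm
      rw [e]
      refine h.ne_zero_of_mem_Ioo ⟨hu.1.trans_le (Real.le_sqrt_of_sq_le hs.1), ?_⟩
      exact lt_of_le_of_lt (Real.sqrt_le_iff.2 ⟨(hupos.trans huv).le, hs.2⟩) hv.2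
    exact le_antisymm (not_lt.1 (key _ _ (hy n) hn (hy0 n) h0))
      (not_lt.1 (key _ _ hn (hy n) h0 (hy0 n)))

end

/-! ### Branches of the Struve function and their derivatives -/

/-- The nowhere vanishing factor of a branch of the Struve function. -/
def struveFactor (ν : ℝ) (L : ℂ → ℂ) (z : ℂ) : ℂ :=
  Complex.exp (((ν : ℂ) + 1) * (L z - (Real.log 2 : ℝ))) /
      ((Real.sqrt (Real.pi / 4) * Real.Gamma (ν + 3 / 2) : ℝ) : ℂ)

theorem struveBranch_eq (ν : ℝ) (L : ℂ → ℂ) (z : ℂ) :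
    struveBranch ν L z = struveFactor ν L z * struveEntire ν (z ^ 2) := by
  rw [struveBranch, struveFactor, struveEntire]

theorem struveFactor_ne_zero {ν : ℝ} (hν : -1 / 2 ≤ ν) (L : ℂ → ℂ) (z : ℂ) :
    struveFactor ν L z ≠ 0 := by
  have h1 : 0 < Real.Gamma (ν + 3 / 2) := Real.Gamma_pos_of_pos (by linarith)
  have h2 : 0 < Real.sqrt (Real.pi / 4) := Real.sqrt_pos.2 (by positivity)
  refine div_ne_zero (Complex.exp_ne_zero _) ?_
  exact_mod_cast (mul_pos h2 h1).ne'

section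

variable {U : Set ℂ} {L : ℂ → ℂ}

theorem IsLogBranch.ne_zero (h : IsLogBranch U L) {z : ℂ} (hz : z ∈ U) : z ≠ 0 := by
  rw [← h.exp_eq z hz]
  exact Complex.exp_ne_zero _

theorem IsLogBranch.hasDerivAt (h : IsLogBranch U L) {z : ℂ} (hz : z ∈ U) :
    HasDerivAt L z⁻¹ z := by
  have hd := (h.differentiableOn.differentiableAt (h.isOpen.mem_nhds hz)).hasDerivAt
  have he := hd.cexp
  have hid : (fun z => Complex.exp (L z)) =ᶠ[𝓝 z] id := by
    filter_upwards [h.isOpen.mem_nhds hz] with w hw using h.exp_eq w hw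
  have hu := (he.congr_of_eventuallyEq hid.symm).unique (hasDerivAt_id z)
  rw [h.exp_eq z hz] at hu
  rwa [← eq_inv_of_mul_eq_one_right hu]

theorem IsLogBranch.hasDerivAt_struveFactor (h : IsLogBranch U L) (ν : ℝ) {z : ℂ} (hz : z ∈ U) :
    HasDerivAt (struveFactor ν L) (struveFactor ν L z * ((ν + 1) / z)) z := by
  have h1 := ((((h.hasDerivAt hz).sub_const ((Real.log 2 : ℝ) : ℂ)).const_mul
    ((ν : ℂ) + 1)).cexp).div_const
      ((Real.sqrt (Real.pi / 4) * Real.Gamma (ν + 3 / 2) : ℝ) : ℂ)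
  convert! h1 using 1
  rw [struveFactor]
  ring

theorem IsLogBranch.hasDerivAt_struveBranch (h : IsLogBranch U L) (ν : ℝ) {z : ℂ} (hz : z ∈ U) :
    HasDerivAt (struveBranch ν L)
      (struveFactor ν L z / z * sqLogDeriv (ν + 1) (struveEntire ν) (z ^ 2)) z := by
  have hz0 := h.ne_zero hz
  have h1 := h.hasDerivAt_struveFactor ν hz
  have h2 := HasDerivAt.comp (h := fun z : ℂ => z ^ 2) z
    ((differentiable_struveEntire ν).differentiableAt (x := z ^ 2)).hasDerivAt (hasDerivAt_pow 2 z)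
  rw [show struveBranch ν L = fun z => struveFactor ν L z * struveEntire ν (z ^ 2) from
    funext (struveBranch_eq ν L)]
  convert! h1.mul h2 using 1
  rw [sqLogDeriv]
  push_cast
  simp only [Function.comp_apply]
  field_simp

theorem IsLogBranch.deriv_struveBranch (h : IsLogBranch U L) (ν : ℝ) {z : ℂ} (hz : z ∈ U) :
    deriv (struveBranch ν L) z =
      struveFactor ν L z / z * sqLogDeriv (ν + 1) (struveEntire ν) (z ^ 2) :=
  (h.hasDerivAt_struveBranch ν hz).deriv

/-- The derivative of the prefactor drops out because it multiplies d(z²) = 0, so simplicity of the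
zero of d transfers directly. -/
theorem IsLogBranch.deriv_deriv_struveBranch (h : IsLogBranch U L) (ν : ℝ) {z : ℂ} (hz : z ∈ U)
    (h0 : sqLogDeriv (ν + 1) (struveEntire ν) (z ^ 2) = 0) :
    deriv (deriv (struveBranch ν L)) z =
      2 * struveFactor ν L z * deriv (sqLogDeriv (ν + 1) (struveEntire ν)) (z ^ 2) := by
  have hz0 := h.ne_zero hz
  have e : deriv (struveBranch ν L) =ᶠ[𝓝 z] fun z =>
      struveFactor ν L z / z * sqLogDeriv (ν + 1) (struveEntire ν) (z ^ 2) := by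
    filter_upwards [h.isOpen.mem_nhds hz] with w hw using h.deriv_struveBranch ν hw
  have h1 := (h.hasDerivAt_struveFactor ν hz).div (hasDerivAt_id z) hz0
  have h2 := HasDerivAt.comp (h := fun z : ℂ => z ^ 2) z
    (hasDerivAt_sqLogDeriv (a := ν + 1) (differentiable_struveEntire ν)
      (z ^ 2)).differentiableAt.hasDerivAt (hasDerivAt_pow 2 z)
  have h3 := (h1.mul h2).deriv
  rw [e.deriv_eq]
  refine h3.trans ?_
  simp only [Function.comp_apply, h0, mul_zero, zero_add, Pi.div_apply, id_eq]
  push_cast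
  field_simp

end

theorem isLogBranch_log : IsLogBranch Complex.slitPlane Complex.log where
  isOpen := Complex.isOpen_slitPlane
  differentiableOn := fun _ hz => (Complex.differentiableAt_log hz).differentiableWithinAt
  exp_eq := fun _ hz => Complex.exp_log (Complex.slitPlane_ne_zero hz)

theorem struveH_eventuallyEq (ν : ℝ) {z : ℂ} (hz : z ≠ 0) :
    struveH ν =ᶠ[𝓝 z] struveBranch ν Complex.log := by
  filter_upwards [isOpen_ne.mem_nhds hz] with w hw using (struveBranch_log ν hw).symm

theorem ofReal_mem_slitPlane_of_pos {x : ℝ} (hx : 0 < x) : (x : ℂ) ∈ Complex.slitPlane :=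
  Complex.ofReal_mem_slitPlane.2 hx

theorem analyticAt_struveH (ν : ℝ) {x : ℝ} (hx : 0 < x) : AnalyticAt ℂ (struveH ν) x := by
  have hd : DifferentiableOn ℂ (struveH ν) Complex.slitPlane := fun z hz =>
    ((struveH_eventuallyEq ν (Complex.slitPlane_ne_zero hz)).differentiableAt_iff.2
      (isLogBranch_log.hasDerivAt_struveBranch ν hz).differentiableAt).differentiableWithinAt
  exact hd.analyticAt (Complex.isOpen_slitPlane.mem_nhds (ofReal_mem_slitPlane_of_pos hx))

theorem struveH_eq (ν : ℝ) {x : ℝ} (hx : 0 < x) :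
    struveH ν x = struveFactor ν Complex.log x * struveEntire ν ((x ^ 2 : ℝ) : ℂ) := by
  rw [(struveH_eventuallyEq ν (by exact_mod_cast hx.ne')).eq_of_nhds, struveBranch_eq]
  push_cast
  rfl

theorem deriv_struveH (ν : ℝ) {x : ℝ} (hx : 0 < x) :
    deriv (struveH ν) x = struveFactor ν Complex.log x / x *
      sqLogDeriv (ν + 1) (struveEntire ν) ((x ^ 2 : ℝ) : ℂ) := by
  rw [(struveH_eventuallyEq ν (by exact_mod_cast hx.ne')).deriv_eq,
    isLogBranch_log.deriv_struveBranch ν (ofReal_mem_slitPlane_of_pos hx)]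
  push_cast
  rfl

theorem deriv_deriv_struveH (ν : ℝ) {x : ℝ} (hx : 0 < x)
    (h0 : sqLogDeriv (ν + 1) (struveEntire ν) ((x ^ 2 : ℝ) : ℂ) = 0) :
    deriv (deriv (struveH ν)) x = 2 * struveFactor ν Complex.log x *
      deriv (sqLogDeriv (ν + 1) (struveEntire ν)) ((x ^ 2 : ℝ) : ℂ) := by
  rw [(struveH_eventuallyEq ν (by exact_mod_cast hx.ne')).deriv.deriv_eq,
    isLogBranch_log.deriv_deriv_struveBranch ν (ofReal_mem_slitPlane_of_pos hx)
      (by push_cast at h0; exact h0)]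
  push_cast
  rfl

/-! ### Multiplicities and assembly -/

theorem EnumeratesPosZeros.of_simple {f : ℂ → ℂ} {a : ℕ → ℝ} (hpos : ∀ n, 0 < a n)
    (ha : StrictMono a) (hf : ∀ x : ℝ, 0 < x → AnalyticAt ℂ f x) (hzero : ∀ n, f (a n) = 0)
    (hsimple : ∀ n, deriv f (a n) ≠ 0) (hex : ∀ x : ℝ, 0 < x → f x = 0 → ∃ n, x = a n) :
    EnumeratesPosZeros f a where
  pos := hpos
  monotone := ha.monotone
  multiplicity x hx := by
    by_cases h : f x = 0
    · obtain ⟨n, rfl⟩ := hex x hx h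
      rw [(hf _ hx).analyticOrderAt_eq_one_of_zero_deriv_ne_zero h (hsimple n)]
      have : {m : ℕ | a m = a n} = {n} := by
        ext m
        simp [ha.injective.eq_iff]
      rw [this, Set.encard_singleton]
    · rw [(hf x hx).analyticOrderAt_eq_zero.2 h, Set.encard_eq_zero, Set.eq_empty_iff_forall_notMem]
      rintro m rfl
      exact h (hzero m)

/-- The order of f at a zero is one more than that of f', which has a simple zero there; the index n
/ 2 lists every zero twice. -/
theorem EnumeratesPosZeros.of_double {f : ℂ → ℂ} {a : ℕ → ℝ} (hpos : ∀ n, 0 < a n)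
    (ha : StrictMono a) (hf : ∀ x : ℝ, 0 < x → AnalyticAt ℂ f x) (hzero : ∀ n, f (a n) = 0)
    (hzero' : ∀ n, deriv f (a n) = 0) (hdouble : ∀ n, deriv (deriv f) (a n) ≠ 0)
    (hex : ∀ x : ℝ, 0 < x → f x = 0 → ∃ n, x = a n) :
    EnumeratesPosZeros f fun n => a (n / 2) where
  pos n := hpos _
  monotone m n h := ha.monotone (Nat.div_le_div_right h)
  multiplicity x hx := by
    by_cases h : f x = 0
    · obtain ⟨n, rfl⟩ := hex x hx h
      have h1 := (hf _ hx).deriv.analyticOrderAt_eq_one_of_zero_deriv_ne_zero (hzero' n) (hdouble n)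
      have h2 := (hf _ hx).analyticOrderAt_deriv_add_one
      simp only [h, sub_zero] at h2
      rw [← h2, h1]
      have : {m : ℕ | a (m / 2) = a n} = {2 * n, 2 * n + 1} := by
        ext m
        simp only [Set.mem_ofPred_eq, ha.injective.eq_iff, Set.mem_insert_iff,
          Set.mem_singleton_iff]
        lia
      rw [this, Set.encard_pair (by lia)]
      rfl
    · rw [(hf x hx).analyticOrderAt_eq_zero.2 h, Set.encard_eq_zero, Set.eq_empty_iff_forall_notMem]
      rintro m rfl
      exact h (hzero _)

theorem deriv_deriv_struveEntire_ne_zero {ν : ℝ} (h0 : -1 / 2 ≤ ν) (h1 : ν ≤ 1 / 2) (x : ℝ)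
    (hx : 0 < x) (hq : struveEntire ν x = 0) (hq' : deriv (struveEntire ν) x = 0) :
    deriv (deriv (struveEntire ν)) x ≠ 0 := by
  have e : x = √x ^ 2 := (Real.sq_sqrt hx.le).symm
  rw [e] at hq hq' ⊢
  rcases h1.eq_or_lt with rfl | h1
  · obtain ⟨n, hn⟩ := isSqZeroSeq_half.exists_eq _ (Real.sqrt_pos.2 hx) hq
    rw [hn]
    exact deriv_deriv_struveEntire_half_ne_zero n
  · obtain ⟨u, hu, hu'⟩ := exists_isSqZeroSeq h0 h1
    obtain ⟨n, hn⟩ := hu.exists_eq _ (Real.sqrt_pos.2 hx) hq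
    rw [hn] at hq'
    exact absurd hq' (hu' n)

theorem im_eq_zero_of_sq_pos {z : ℂ} (h : (z ^ 2).im = 0) (h' : 0 < (z ^ 2).re) : z.im = 0 := by
  have h1 : z.re * z.im + z.im * z.re = 0 := by simpa [sq] using h
  have h2 : 0 < z.re * z.re - z.im * z.im := by simpa [sq] using h'
  have h3 : z.re * z.im = 0 := by linarith
  rcases mul_eq_zero.1 h3 with h4 | h4
  · rw [h4] at h2
    nlinarith [mul_self_nonneg z.im]
  · exact h4

theorem mainTheorem4 (ν : ℝ) (hν : |ν| ≤ 1 / 2) :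
    -- all zeros of every branch of the Struve function are real
    (∀ (U : Set ℂ) (L : ℂ → ℂ), IsLogBranch U L →
      ∀ z ∈ U, struveBranch ν L z = 0 → z.im = 0) ∧
    -- all zeros of the derivative of every branch are real and simple
    (∀ (U : Set ℂ) (L : ℂ → ℂ), IsLogBranch U L →
      ∀ z ∈ U, deriv (struveBranch ν L) z = 0 →
        z.im = 0 ∧ deriv (deriv (struveBranch ν L)) z ≠ 0) ∧
    -- the positive zeros `h n` of the function and `h' n` of its derivative interlace
    ∃ h h' : ℕ → ℝ,
      EnumeratesPosZeros (struveH ν) h ∧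
      EnumeratesPosZeros (deriv (struveH ν)) h' ∧
      StrictMono h' ∧
      (∀ n, h' n ≤ h n ∧ h n ≤ h' (n + 1)) ∧
      (ν < 1 / 2 → ∀ n, h' n < h n ∧ h n < h' (n + 1)) := by
  have hL := posRootLimit_struveEntire hν
  obtain ⟨h0, h1⟩ := abs_le.1 hν
  rw [← neg_div] at h0
  have hq := differentiable_struveEntire ν
  have hreal := struveEntire_ofReal h0
  have ha : 0 < ν + 1 := by linarith
  have hsimple : ∀ w, sqLogDeriv (ν + 1) (struveEntire ν) w = 0 →
      deriv (sqLogDeriv (ν + 1) (struveEntire ν)) w ≠ 0 := fun w hw =>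
    deriv_sqLogDeriv_ne_zero hL hreal hq ha (deriv_deriv_struveEntire_ne_zero h0 h1) hw
  have hfac := struveFactor_ne_zero h0
  have hH0 : ∀ x : ℝ, 0 < x → (struveH ν x = 0 ↔ struveEntire ν ((x ^ 2 : ℝ) : ℂ) = 0) := by
    intro x hx
    rw [struveH_eq ν hx, mul_eq_zero, or_iff_right (hfac _ _)]
  have hH1 : ∀ x : ℝ, 0 < x → (deriv (struveH ν) x = 0 ↔
      sqLogDeriv (ν + 1) (struveEntire ν) ((x ^ 2 : ℝ) : ℂ) = 0) := by
    intro x hx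
    rw [deriv_struveH ν hx, mul_eq_zero, or_iff_right]
    exact div_ne_zero (hfac _ _) (by exact_mod_cast hx.ne')
  have hH2 : ∀ x : ℝ, 0 < x → deriv (struveH ν) x = 0 → deriv (deriv (struveH ν)) x ≠ 0 := by
    intro x hx h
    rw [hH1 x hx] at h
    rw [deriv_deriv_struveH ν hx h]
    exact mul_ne_zero (mul_ne_zero two_ne_zero (hfac _ _)) (hsimple _ h)
  have han := fun x (hx : 0 < x) => analyticAt_struveH ν hx
  have han' := fun x (hx : 0 < x) => (analyticAt_struveH ν hx).deriv
  refine ⟨fun U L hU z hz h => ?_, fun U L hU z hz h => ?_, ?_⟩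
  · rw [struveBranch_eq, mul_eq_zero, or_iff_right (hfac _ _)] at h
    obtain ⟨h2, h3⟩ := hL.zeros_pos hq h
    exact im_eq_zero_of_sq_pos h2 h3
  · rw [hU.deriv_struveBranch ν hz, mul_eq_zero,
      or_iff_right (div_ne_zero (hfac _ _) (hU.ne_zero hz))] at h
    obtain ⟨h2, h3⟩ := sqLogDeriv_zeros hL hq ha h
    refine ⟨im_eq_zero_of_sq_pos h2 h3, ?_⟩
    rw [hU.deriv_deriv_struveBranch ν hz h]
    exact mul_ne_zero (mul_ne_zero two_ne_zero (hfac _ _)) (hsimple _ h)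
  · rcases h1.eq_or_lt with rfl | h1
    · have hx := isSqZeroSeq_half
      set x := fun n : ℕ => 2 * (((n : ℝ) + 1) * Real.pi)
      obtain ⟨y, hypos, hyx, hxy, hy0, hyex⟩ := hx.exists_critical_seq hL hreal hq ha
      -- Here the zeros of q are double, so they are critical points in addition to the Rolle
      -- points.
      have hx' : ∀ n, sqLogDeriv (1 / 2 + 1) (struveEntire (1 / 2)) ((x n ^ 2 : ℝ) : ℂ) = 0 := by
        intro n
        have e : ((x n ^ 2 : ℝ) : ℂ) / 4 = (((((n : ℝ) + 1) * Real.pi) ^ 2 : ℝ) : ℂ) := by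
          simp only [x]; push_cast; ring
        rw [sqLogDeriv, hx.zero n, (hasDerivAt_struveEntire_half _).deriv, e,
          isSqZeroSeq_neg_half.zero n]
        ring
      -- The critical points alternate, y 0 < x 0 < y 1 < x 1 < …. The double zero x k is v (2k+1),
      -- while the zeros of the function carry it at indices 2k and 2k+1, so one inequality at each
      -- index is an equality.
      set v : ℕ → ℝ := fun n => if n % 2 = 0 then y (n / 2) else x (n / 2) with hv
      have hv0 : ∀ n, v (2 * n) = y n := fun n => by
        simp only [hv]
        rw [if_pos (by lia), Nat.mul_div_cancel_left n two_pos]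
      have hv1 : ∀ n, v (2 * n + 1) = x n := fun n => by
        simp only [hv]
        rw [if_neg (by lia), show (2 * n + 1) / 2 = n by lia]
      have hvmono : StrictMono v := by
        refine strictMono_nat_of_lt_succ fun n => ?_
        obtain ⟨k, rfl | rfl⟩ := n.even_or_odd'
        · rw [hv0, hv1]; exact hyx k
        · rw [hv1, show 2 * k + 1 + 1 = 2 * (k + 1) by ring, hv0]; exact hxy k
      have hvpos : ∀ n, 0 < v n := fun n => by
        obtain ⟨k, rfl | rfl⟩ := n.even_or_odd'
        · rw [hv0]; exact hypos k
        · rw [hv1]; exact hx.pos k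
      have hvz : ∀ n, deriv (struveH (1 / 2)) (v n) = 0 := fun n => by
        rw [hH1 _ (hvpos n)]
        obtain ⟨k, rfl | rfl⟩ := n.even_or_odd'
        · rw [hv0]; exact hy0 k
        · rw [hv1]; exact hx' k
      have hxz : ∀ n, deriv (struveH (1 / 2)) (x n) = 0 := fun n =>
        (hH1 _ (hx.pos n)).2 (hx' n)
      refine ⟨fun n => x (n / 2), v,
        .of_double hx.pos hx.strictMono han (fun n => (hH0 _ (hx.pos n)).2 (hx.zero n)) hxz
          (fun n => hH2 _ (hx.pos n) (hxz n))
          (fun t ht h => hx.exists_eq t ht ((hH0 t ht).1 h)),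
        .of_simple hvpos hvmono han' hvz (fun n => hH2 _ (hvpos n) (hvz n)) ?_, hvmono, ?_,
        fun h => absurd h (lt_irrefl _)⟩
      · intro t ht h
        by_cases hqt : struveEntire (1 / 2) ((t ^ 2 : ℝ) : ℂ) = 0
        · obtain ⟨n, rfl⟩ := hx.exists_eq t ht hqt
          exact ⟨2 * n + 1, (hv1 n).symm⟩
        · obtain ⟨n, rfl⟩ := hyex t ht hqt ((hH1 t ht).1 h)
          exact ⟨2 * n, (hv0 n).symm⟩
      · intro n
        obtain ⟨k, rfl | rfl⟩ := n.even_or_odd'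
        · simp only [hv0, hv1, Nat.mul_div_cancel_left k two_pos]
          exact ⟨(hyx k).le, le_rfl⟩
        · simp only [show 2 * k + 1 + 1 = 2 * (k + 1) by ring, hv0, hv1,
            show (2 * k + 1) / 2 = k by lia]
          exact ⟨le_rfl, (hxy k).le⟩
    · obtain ⟨x, hx, hx'⟩ := exists_isSqZeroSeq h0 h1
      obtain ⟨y, hypos, hyx, hxy, hy0, hyex⟩ := hx.exists_critical_seq hL hreal hq ha
      have hymono : StrictMono y := strictMono_nat_of_lt_succ fun n => (hyx n).trans (hxy n)
      have hyz : ∀ n, deriv (struveH ν) (y n) = 0 := fun n => (hH1 _ (hypos n)).2 (hy0 n)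
      -- For ν < 1/2 the zeros of q are simple, so no zero of the function is critical and the Rolle
      -- points exhaust the critical points.
      have hsq : ∀ t : ℝ, 0 < t → struveEntire ν ((t ^ 2 : ℝ) : ℂ) = 0 →
          deriv (struveH ν) t ≠ 0 := by
        intro t ht hqt hd
        obtain ⟨n, rfl⟩ := hx.exists_eq t ht hqt
        rw [hH1 _ ht, sqLogDeriv, hqt, mul_zero, zero_add] at hd
        refine mul_ne_zero (mul_ne_zero two_ne_zero ?_) (hx' n) hd
        exact_mod_cast (pow_pos ht 2).ne'
      refine ⟨x, y,
        .of_simple hx.pos hx.strictMono han (fun n => (hH0 _ (hx.pos n)).2 (hx.zero n))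
          (fun n => hsq _ (hx.pos n) (hx.zero n))
          (fun t ht h => hx.exists_eq t ht ((hH0 t ht).1 h)),
        .of_simple hypos hymono han' hyz (fun n => hH2 _ (hypos n) (hyz n))
          (fun t ht h => hyex t ht (fun hqt => hsq t ht hqt h) ((hH1 t ht).1 h)), hymono,
        fun n => ⟨(hyx n).le, (hxy n).le⟩, fun _ n => ⟨hyx n, hxy n⟩⟩

end
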